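/- **Setting.** Let $m\ge 2$, $r\ge 1$, $q\ge 0$ be integers, put $n+1=rm+q$, and let $\omega\in\mathbb C$ be a primitive $m$-th root of unity. Let $P=\sum_{a=1}^{m-1}E_{a,a+1}+E_{m,1}$ be the $m\times m$ cyclic permutation matrix, let $f_1,\dots,f_q\in\{0,\dots,m-1\}$ be exponents which do not exhaust $\{0,\dots,m-1\}$ (that is, $r$ is the smallest eigenvalue multiplicity of the matrix $D$ below), and put $$D=\operatorname{diag}(\underbrace{P,\dots,P}_{r},\omega^{f_1},\dots,\omega^{f_q}).$$ Let $\mathfrak g=\mathfrak{sl}_{n+1}(\mathbb C)$, graded by the inner automorphism $\theta(x)=DxD^{-1}$, $\mathfrak g_i=\{x\in\mathfrak g:\theta(x)=\omega^i x\}$ for $i\in\mathbb Z/m\mathbb Z$ (the normal form of an inner grading of positive rank with $m\ge2$). Let $\mathfrak h\subset\mathfrak g$ be the subalgebra of traceless diagonal matrices, with roots $\Phi=\{\epsilon_i-\epsilon_j: i\ne j\}$ and simple roots $\alpha_i=\epsilon_i-\epsilon_{i+1}$, and $\mathfrak c=\mathfrak h\cap\mathfrak g_1$. For $1\le\ell\le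 r$ let $\mathbf s_\ell$ be the block diagonal matrix with $\operatorname{diag}(1,\omega,\dots,\omega^{m-1})$ as its $\ell$-th $m\times m$ block and zeros elsewhere. Let $G_0\subset \mathrm{SL}_{n+1}(\mathbb C)$ be the connected subgroup with Lie algebra $\mathfrak g_0$ (generated by $\exp(\mathfrak g_0)$), and let $W=N_{G_0}(\mathfrak c)/Z_{G_0}(\mathfrak c)\subset \mathrm{GL}(\mathfrak c)$ be the little Weyl group, the quotient being taken with respect to the adjoint action. A complex reflection is an $s\in\mathrm{GL}(\mathfrak c)$ of finite order whose fixed space $\Pi_s=\ker(s-\mathrm{id})$ has dimension $\dim\mathfrak c-1$. Let $\Sigma\subset\mathfrak c^*$ be the set of nonzero restrictions of roots to $\mathfrak c$, and $\Pi_\sigma=\ker\sigma$ for $\sigma\in\Sigma$. For a root $\alpha=\epsilon_i-\epsilon_j$ let $e_\alpha=E_{i,j}$, let $\mathcal O_\alpha$ be the orbit of $\alpha$ under $\theta\cdot\alpha=\alpha\circ\theta^{-1}$, and put $$e^{(0)}_\alpha=\frac{|\mathcal O_\alpha|}{m}\sum_{i=0}^{m-1}\theta^i(e_\alpha).$$ **Theorem.**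 The subspace $\mathfrak c$ is a Cartan subspace (a maximal abelian subspace of $\mathfrak g_1$ consisting of semisimple elements) with basis $\mathbf s_1,\dots,\mathbf s_r$. For every $\sigma\in\Sigma$ exactly one of the following two cases occurs. 1. $\Pi_\sigma=\langle \mathbf s_a : a\neq\ell\rangle$ for some $1\le \ell\le r$. Then, for every $\ell$ as above, every $\varepsilon\in\mathbb C$ with $\varepsilon^m=(-1)^{m+1}$ (such $\varepsilon$ exist) and every $L=(L_0,\dots,L_{m-1})\in\mathbb C^m$ with $\exp(L_j)=\varepsilon\omega^j$ for all $j$, the Vandermonde system $$\sum_{k=0}^{m-1}a_k\,\omega^{jk}=L_j,\qquad 0\le j\le m-1,$$ has the unique solution $a=\frac1m\overline A L$, $A=(\omega^{jk})_{0\le j,k\le m-1}$; it has $a_0=0$ if and only if $\sum_jL_j=0$, and for each such $\varepsilon$ the branches $L_j$ of the logarithms can be chosen with $\sum_j L_j=0$. Moreover $$\exp\Big(\sum_{k=1}^{m-1}a_k\,e^{(0)}_{\alpha_{(\ell-1)m+1}+\cdots+\alpha_{(\ell-1)m+k}}\Big)$$ lies in $N_{G_0}(\mathfrak c)$ and is a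 lift of a complex reflection $s\in W$ with $\Pi_s=\Pi_\sigma$. 2. $\Pi_\sigma=\langle \omega^{-i}\mathbf s_k+\omega^{-j}\mathbf s_\ell,\ \mathbf s_a : a\ne k,\ell\rangle$ for some $1\le k<\ell\le r$, $(k-1)m+1\le i\le km$ and $(\ell-1)m+1\le j\le \ell m$. Then, for all such $k,\ell,i,j$ and $\alpha=\epsilon_i-\epsilon_j$, $$\exp\Big(\frac{\pi}{2}\big(e^{(0)}_\alpha-e^{(0)}_{-\alpha}\big)\Big)$$ lies in $N_{G_0}(\mathfrak c)$ and is a lift of a complex reflection $s\in W$ with $\Pi_s=\Pi_\sigma$. -/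

import Mathlib

attribute [local instance 100] LieRing.ofAssociativeRing

noncomputable section

namespace ThetaGroup

open LieAlgebra.SpecialLinear Kronecker

/-! ### Periodically graded Lie algebras -/

section General

variable {L : Type*} [LieRing L] [LieAlgebra ℂ L]

/-- The homogeneous component of degree `i` of the grading attached to an automorphism `θ`
and a root of unity `ω`: the space of all `x` with `θ x = ω ^ i • x`. -/
def gradedPiece (θ : L ≃ₗ⁅ℂ⁆ L) (ω : ℂ) (i : ℕ) : Submodule ℂ L :=
  Module.End.eigenspace (θ.toLinearEquiv : L →ₗ[ℂ] L) (ω ^ i)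

/-- An abelian subspace of the degree one component that consists of (ad-)semisimple elements. -/
def IsToralSubspace (θ : L ≃ₗ⁅ℂ⁆ L) (ω : ℂ) (U : Submodule ℂ L) : Prop :=
  U ≤ gradedPiece θ ω 1 ∧ (∀ x ∈ U, ∀ y ∈ U, ⁅x, y⁆ = 0) ∧
    ∀ x ∈ U, (LieAlgebra.ad ℂ L x).IsSemisimple

/-- A Cartan subspace: a maximal abelian subspace of the degree one component
consisting of semisimple elements. -/
def IsCartanSubspace (θ : L ≃ₗ⁅ℂ⁆ L) (ω : ℂ) (U : Submodule ℂ L) : Prop :=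
  Maximal (IsToralSubspace θ ω) U

/-- The roots with respect to `h`: the nonzero linear forms on `h` whose root space
is nonzero. -/
def roots (h : Submodule ℂ L) : Set (Module.Dual ℂ h) :=
  {α | α ≠ 0 ∧ ∃ y : L, y ≠ 0 ∧ ∀ x : h, ⁅(x : L), y⁆ = α x • y}

/-- The restricted roots: the nonzero restrictions of the roots to a subspace `c` of `h`. -/
def restrictedRoots {h c : Submodule ℂ L} (hc : c ≤ h) : Set (Module.Dual ℂ c) :=
  {σ | σ ≠ 0 ∧ ∃ β ∈ roots h, σ = β ∘ₗ Submodule.inclusion hc}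

/-- The hyperplane `ker σ` of `c`, regarded as a subspace of the Lie algebra. -/
def hyperplane {c : Submodule ℂ L} (σ : Module.Dual ℂ c) : Submodule ℂ L :=
  (LinearMap.ker σ).map c.subtype

/-- The orbit of a linear form `α` on the `θ`-stable subspace `h` under `θ · α = α ∘ θ⁻¹`:
`β = θ ^ i · α` means that `β (θ ^ i x) = α x` for all `x` in `h`. -/
def rootOrbit (θ : L ≃ₗ⁅ℂ⁆ L) (m : ℕ) (h : Submodule ℂ L) (α : Module.Dual ℂ h) :
    Set (Module.Dual ℂ h) :=
  {β | ∃ i < m, ∀ x y : h, (y : L) = (θ^[i]) (x : L) → β y = α x}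

/-- The element `e_α^{(j)} = (|O_α| / m) ∑_{i < m} ω^{-ij} θ^i (e_α)`, where `e` is the chosen
root vector of the root `α`. -/
def rootAverage (θ : L ≃ₗ⁅ℂ⁆ L) (ω : ℂ) (m : ℕ) (h : Submodule ℂ L) (α : Module.Dual ℂ h)
    (e : L) (j : ℕ) : L :=
  (((rootOrbit θ m h α).ncard : ℂ) / (m : ℂ)) •
    ∑ i ∈ Finset.range m, (ω ^ (i * j))⁻¹ • (θ^[i]) e

/-- A complex reflection of `c`: a linear automorphism of finite order whose fixed space has
codimension one. -/
def IsComplexReflection {c : Submodule ℂ L} (s : c ≃ₗ[ℂ] c) : Prop :=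
  IsOfFinOrder s ∧
    Module.finrank ℂ (LinearMap.ker ((s : c →ₗ[ℂ] c) - LinearMap.id)) + 1 = Module.finrank ℂ c

/-- The fixed space of `s`, regarded as a subspace of the Lie algebra. -/
def fixedSpace {c : Submodule ℂ L} (s : c ≃ₗ[ℂ] c) : Submodule ℂ L :=
  (LinearMap.ker ((s : c →ₗ[ℂ] c) - LinearMap.id)).map c.subtype

end General

/-! ### The group and the little Weyl group for a graded special linear algebra -/

section Group

variable {ι : Type*} [Fintype ι] [DecidableEq ι]

/-- The connected subgroup of `SL` whose Lie algebra is the degree zero component: it is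
generated by the exponentials of the elements of that component. -/
def G0 (θ : sl ι ℂ ≃ₗ⁅ℂ⁆ sl ι ℂ) (ω : ℂ) : Subgroup (Matrix.SpecialLinearGroup ι ℂ) :=
  Subgroup.closure
    {g | ∃ x ∈ gradedPiece θ ω 0, (g : Matrix ι ι ℂ) = NormedSpace.exp (x : Matrix ι ι ℂ)}

/-- `Ad_g` maps `c` to itself and its restriction to `c` is `s`. -/
def AdRestrictsTo {c : Submodule ℂ (sl ι ℂ)} (g : Matrix.SpecialLinearGroup ι ℂ)
    (s : c ≃ₗ[ℂ] c) : Prop :=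
  ∀ x : c, ((s x : sl ι ℂ) : Matrix ι ι ℂ) =
    (g : Matrix ι ι ℂ) * ((x : sl ι ℂ) : Matrix ι ι ℂ) *
      ((g⁻¹ : Matrix.SpecialLinearGroup ι ℂ) : Matrix ι ι ℂ)

/-- The little Weyl group `N_{G_0}(c) / Z_{G_0}(c)`, realised as the group of all linear
automorphisms of `c` that are induced by elements of `N_{G_0}(c)`. -/
def littleWeylGroup (θ : sl ι ℂ ≃ₗ⁅ℂ⁆ sl ι ℂ) (ω : ℂ) (c : Submodule ℂ (sl ι ℂ)) :
    Subgroup (c ≃ₗ[ℂ] c) where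
  carrier := {s | ∃ g ∈ G0 θ ω, AdRestrictsTo g s}
  one_mem' := ⟨1, one_mem _, fun x => by simp⟩
  mul_mem' := by
    rintro s t ⟨g, hg, hgs⟩ ⟨k, hk, hkt⟩
    refine ⟨g * k, mul_mem hg hk, fun x => ?_⟩
    rw [LinearEquiv.mul_apply, hgs, hkt, mul_inv_rev]
    simp only [Matrix.SpecialLinearGroup.coe_mul, Matrix.mul_assoc]
  inv_mem' := by
    rintro s ⟨g, hg, hgs⟩
    refine ⟨g⁻¹, inv_mem hg, fun x => ?_⟩
    have h := hgs (s⁻¹ x)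
    have e : s (s⁻¹ x) = x := LinearEquiv.apply_symm_apply s x
    rw [e] at h
    rw [h, inv_inv]
    have h1 : ((g⁻¹ : Matrix.SpecialLinearGroup ι ℂ) : Matrix ι ι ℂ) * (g : Matrix ι ι ℂ) = 1 := by
      rw [← Matrix.SpecialLinearGroup.coe_mul, inv_mul_cancel, Matrix.SpecialLinearGroup.coe_one]
    simp only [Matrix.mul_assoc, h1, Matrix.mul_one]
    rw [← Matrix.mul_assoc, h1, Matrix.one_mul]

/-- The exponential of `X` is an element of `N_{G_0}(c)` that lifts some complex reflection
`s` in the little Weyl group whose fixed hyperplane is `ker σ`. -/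
def ExpLiftsReflection (θ : sl ι ℂ ≃ₗ⁅ℂ⁆ sl ι ℂ) (ω : ℂ) {c : Submodule ℂ (sl ι ℂ)}
    (σ : Module.Dual ℂ c) (X : sl ι ℂ) : Prop :=
  ∃ g ∈ G0 θ ω, (g : Matrix ι ι ℂ) = NormedSpace.exp (X : Matrix ι ι ℂ) ∧
    ∃ s ∈ littleWeylGroup θ ω c,
      AdRestrictsTo g s ∧ IsComplexReflection s ∧ fixedSpace s = hyperplane σ

end Group

/-! ### The normal form of an inner grading of `sl_{n+1}`, with `n + 1 = r m + q` -/

section Inner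

/-- The index set of the standard basis of `ℂ^{n+1} = ℂ^{rm} ⊕ ℂ^q`: the pair `(ℓ, a)` is the
position `a` (counted from `0`) in the block `ℓ`, that is, the position `ℓ m + a`; the last `q`
positions make up the second summand. -/
abbrev Idx (m r q : ℕ) : Type := (Fin r × Fin m) ⊕ Fin q

variable {m r q : ℕ} [NeZero m]

/-- The cyclic permutation matrix; addition in `Fin m` is cyclic. -/
def cyclicP (m : ℕ) [NeZero m] : Matrix (Fin m) (Fin m) ℂ :=
  Matrix.of fun a b => if b = a + 1 then 1 else 0

/-- The block diagonal matrix `diag(P, …, P, ω^{f 0}, …, ω^{f (q-1)})` with `r` blocks `P`. -/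
def gradingMatrix (r : ℕ) (ω : ℂ) (f : Fin q → Fin m) :
    Matrix (Idx m r q) (Idx m r q) ℂ :=
  Matrix.fromBlocks ((1 : Matrix (Fin r) (Fin r) ℂ) ⊗ₖ cyclicP m) 0 0
    (Matrix.diagonal fun b => ω ^ (f b : ℕ))

theorem cyclicP_mul_transpose : cyclicP m * (cyclicP m).transpose = 1 := by
  ext a b
  simp only [Matrix.mul_apply, Matrix.transpose_apply, cyclicP, Matrix.of_apply, Matrix.one_apply]
  simp [eq_comm]

theorem isUnit_det_gradingMatrix (r : ℕ) {ω : ℂ} (hω : IsPrimitiveRoot ω m)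
    (f : Fin q → Fin m) : IsUnit (gradingMatrix r ω f).det := by
  have h0 : ω ≠ 0 := hω.ne_zero (NeZero.ne m)
  have hP : IsUnit (cyclicP m).det :=
    Matrix.isUnit_det_of_right_inverse cyclicP_mul_transpose
  rw [gradingMatrix, Matrix.det_fromBlocks_zero₂₁, Matrix.det_kronecker, Matrix.det_diagonal]
  refine IsUnit.mul (IsUnit.mul ?_ (hP.pow _)) ?_
  · simp
  · exact isUnit_iff_ne_zero.2 (Finset.prod_ne_zero_iff.2 fun b _ => pow_ne_zero _ h0)

/-- Conjugation by an invertible matrix, as an automorphism of the special linear algebra. -/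
def conjSl {ι : Type*} [Fintype ι] [DecidableEq ι] (D : Matrix ι ι ℂ) (hD : IsUnit D.det) :
    sl ι ℂ ≃ₗ⁅ℂ⁆ sl ι ℂ where
  toFun x := ⟨D * (x : Matrix ι ι ℂ) * D⁻¹, by
    have hx : Matrix.trace (x : Matrix ι ι ℂ) = 0 := x.2
    change Matrix.trace (D * x.1 * D⁻¹) = 0
    rw [Matrix.trace_mul_cycle, Matrix.nonsing_inv_mul _ hD, Matrix.one_mul, hx]⟩
  invFun x := ⟨D⁻¹ * (x : Matrix ι ι ℂ) * D, by
    have hx : Matrix.trace (x : Matrix ι ι ℂ) = 0 := x.2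
    change Matrix.trace (D⁻¹ * x.1 * D) = 0
    rw [Matrix.trace_mul_cycle, Matrix.mul_nonsing_inv _ hD, Matrix.one_mul, hx]⟩
  map_add' x y := Subtype.ext <| by
    change D * ((x : Matrix ι ι ℂ) + y) * D⁻¹ = D * x * D⁻¹ + D * y * D⁻¹
    rw [Matrix.mul_add, Matrix.add_mul]
  map_smul' a x := Subtype.ext <| by
    change D * (a • (x : Matrix ι ι ℂ)) * D⁻¹ = a • (D * x * D⁻¹)
    rw [Matrix.mul_smul, Matrix.smul_mul]
  map_lie' := by
    intro x y
    apply Subtype.ext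
    change D * ((x : Matrix ι ι ℂ) * y - y * x) * D⁻¹ =
      (D * x * D⁻¹) * (D * y * D⁻¹) - (D * y * D⁻¹) * (D * x * D⁻¹)
    have key : ∀ u v : Matrix ι ι ℂ, (D * u * D⁻¹) * (D * v * D⁻¹) = D * (u * v) * D⁻¹ := by
      intro u v
      calc (D * u * D⁻¹) * (D * v * D⁻¹) = D * u * (D⁻¹ * D) * v * D⁻¹ := by
            simp only [Matrix.mul_assoc]
        _ = D * (u * v) * D⁻¹ := by
            rw [Matrix.nonsing_inv_mul _ hD, Matrix.mul_one]; simp only [Matrix.mul_assoc]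
    rw [key, key, Matrix.mul_sub, Matrix.sub_mul]
  left_inv x := Subtype.ext <| by
    change D⁻¹ * (D * (x : Matrix ι ι ℂ) * D⁻¹) * D = x
    have := Matrix.nonsing_inv_mul _ hD
    calc D⁻¹ * (D * (x : Matrix ι ι ℂ) * D⁻¹) * D = (D⁻¹ * D) * x * (D⁻¹ * D) := by
          simp only [Matrix.mul_assoc]
      _ = x := by rw [this, Matrix.one_mul, Matrix.mul_one]
  right_inv x := Subtype.ext <| by
    change D * (D⁻¹ * (x : Matrix ι ι ℂ) * D) * D⁻¹ = x
    have := Matrix.mul_nonsing_inv _ hD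
    calc D * (D⁻¹ * (x : Matrix ι ι ℂ) * D) * D⁻¹ = (D * D⁻¹) * x * (D * D⁻¹) := by
          simp only [Matrix.mul_assoc]
      _ = x := by rw [this, Matrix.one_mul, Matrix.mul_one]

/-- The inner automorphism in normal form: conjugation by the grading matrix. -/
def theta (r : ℕ) {ω : ℂ} (hω : IsPrimitiveRoot ω m) (f : Fin q → Fin m) :
    sl (Idx m r q) ℂ ≃ₗ⁅ℂ⁆ sl (Idx m r q) ℂ :=
  conjSl (gradingMatrix r ω f) (isUnit_det_gradingMatrix r hω f)

/-- The standard Cartan subalgebra: the traceless diagonal matrices. -/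
def diagCartan (ι : Type*) [Fintype ι] [DecidableEq ι] : Submodule ℂ (sl ι ℂ) where
  carrier := {x | (x : Matrix ι ι ℂ).IsDiag}
  zero_mem' := Matrix.isDiag_zero
  add_mem' hx hy := Matrix.IsDiag.add hx hy
  smul_mem' a _ hx := Matrix.IsDiag.smul a hx

/-- The linear form `ε_i - ε_j` on the traceless diagonal matrices. -/
def epsDiff {ι : Type*} [Fintype ι] [DecidableEq ι] (i j : ι) :
    Module.Dual ℂ (diagCartan ι) :=
  (Matrix.entryLinearMap ℂ ℂ i i - Matrix.entryLinearMap ℂ ℂ j j) ∘ₗ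
    (sl ι ℂ).toSubmodule.subtype ∘ₗ (diagCartan ι).subtype

/-- The subspace `c`: the degree one component of the standard Cartan subalgebra. -/
def cartanC (r : ℕ) {ω : ℂ} (hω : IsPrimitiveRoot ω m) (f : Fin q → Fin m) :
    Submodule ℂ (sl (Idx m r q) ℂ) :=
  diagCartan (Idx m r q) ⊓ gradedPiece (theta r hω f) ω 1

/-- The restricted roots of the grading in normal form. -/
def sigmaSet (r : ℕ) {ω : ℂ} (hω : IsPrimitiveRoot ω m) (f : Fin q → Fin m) :
    Set (Module.Dual ℂ (cartanC r hω f)) :=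
  restrictedRoots (h := diagCartan (Idx m r q)) (c := cartanC r hω f) inf_le_left

/-- The element `e_α^{(0)}` for `α = ε_i - ε_j`, the root vectors being the matrix units. -/
def e0 {ω : ℂ} (hω : IsPrimitiveRoot ω m) (f : Fin q → Fin m) {i j : Idx m r q} (hij : i ≠ j) :
    sl (Idx m r q) ℂ :=
  rootAverage (theta r hω f) ω m (diagCartan (Idx m r q)) (epsDiff i j) (single i j hij 1) 0

/-- The matrix `s_ℓ`, with `diag(1, ω, …, ω^{m-1})` in block `ℓ` and zeros elsewhere. -/
def sVec {ω : ℂ} (hω : IsPrimitiveRoot ω m) (hm : 1 < m) (q : ℕ) (l : Fin r) :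
    sl (Idx m r q) ℂ :=
  ⟨Matrix.diagonal (Sum.elim (fun p => if p.1 = l then ω ^ (p.2 : ℕ) else 0) fun _ => 0), by
    change Matrix.trace _ = 0
    have h : ∑ a : Fin m, ω ^ (a : ℕ) = 0 := by
      rw [Fin.sum_univ_eq_sum_range (fun i => ω ^ i) m]
      exact hω.geom_sum_eq_zero hm
    rw [Matrix.trace_diagonal, Fintype.sum_sum_type, Fintype.sum_prod_type]
    simp [Finset.sum_ite_irrel, h]⟩

/-- The subspace spanned by all `s_a` with `a ≠ ℓ`. -/
def hyperplaneOne {ω : ℂ} (hω : IsPrimitiveRoot ω m) (hm : 1 < m) (q : ℕ) (l : Fin r) :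
    Submodule ℂ (sl (Idx m r q) ℂ) :=
  Submodule.span ℂ (sVec hω hm q '' {a | a ≠ l})

/-- The subspace spanned by `ω^{-i} s_k + ω^{-j} s_ℓ` and all `s_a` with `a ≠ k, ℓ`, where `i` and
`j` are the positions in the blocks `k` and `ℓ`, counted from `1`. (Only `i` and `j` modulo `m`
matter for the powers of `ω`.) -/
def hyperplaneTwo {ω : ℂ} (hω : IsPrimitiveRoot ω m) (hm : 1 < m) (q : ℕ) (k l : Fin r)
    (i j : Fin m) : Submodule ℂ (sl (Idx m r q) ℂ) :=
  Submodule.span ℂ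
    (insert ((ω ^ ((i : ℕ) + 1))⁻¹ • sVec hω hm q k + (ω ^ ((j : ℕ) + 1))⁻¹ • sVec hω hm q l)
      (sVec hω hm q '' {a | a ≠ k ∧ a ≠ l}))

/-- The root vector average `e^{(0)}` of the root
`α_{(ℓ-1)m+1} + ⋯ + α_{(ℓ-1)m+k} = ε_{(ℓ-1)m+1} - ε_{(ℓ-1)m+k+1}` (blocks counted from `1`),
for `1 ≤ k ≤ m - 1`. -/
def e0Row {ω : ℂ} (hω : IsPrimitiveRoot ω m) (f : Fin q → Fin m) (l : Fin r) (k : Fin m)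
    (hk : k ≠ 0) : sl (Idx m r q) ℂ :=
  e0 hω f (i := Sum.inl (l, 0)) (j := Sum.inl (l, k)) (by simpa using hk.symm)

/-- The sum of `a_k e^{(0)}_{α_{(ℓ-1)m+1} + ⋯ + α_{(ℓ-1)m+k}}` over `1 ≤ k ≤ m - 1`. -/
def rowSum {ω : ℂ} (hω : IsPrimitiveRoot ω m) (f : Fin q → Fin m) (l : Fin r)
    (a : Fin m → ℂ) : sl (Idx m r q) ℂ :=
  ∑ k : {k : Fin m // k ≠ 0}, a k • e0Row hω f l k k.2

/-- `π / 2` times `e_α^{(0)} - e_{-α}^{(0)}` for `α = ε_i - ε_j`. -/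
def rotation {ω : ℂ} (hω : IsPrimitiveRoot ω m) (f : Fin q → Fin m) {i j : Idx m r q}
    (hij : i ≠ j) : sl (Idx m r q) ℂ :=
  ((Real.pi : ℂ) / 2) • (e0 hω f hij - e0 hω f hij.symm)

/-- The Vandermonde matrix with entries `(ω^j)^k`, `0 ≤ j, k ≤ m - 1`. -/
def vandermondeA (m : ℕ) (ω : ℂ) : Matrix (Fin m) (Fin m) ℂ :=
  Matrix.vandermonde fun j : Fin m => ω ^ (j : ℕ)

/-- `L` is a vector of logarithms of `ε, ε ω, …, ε ω^{m-1}`, with arbitrary branches. -/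
def IsLogVector (m : ℕ) (ω ε : ℂ) (L : Fin m → ℂ) : Prop :=
  ∀ j : Fin m, Complex.exp (L j) = ε * ω ^ (j : ℕ)

end Inner

end ThetaGroup

end

noncomputable section

namespace ThetaGroup

open LieAlgebra.SpecialLinear Kronecker

/-! ### Exponentials and determinants of explicitly diagonalisable matrices. -/

section Exponential

/-! Everything becomes explicit in the coordinates `t` of `∑ t_l s_l`, whose diagonal entry at
position `a` of block `l` is `t_l ω^a`.

Maximality: if a toral subspace contains `c`, subtract from one of its elements the diagonal part,
which lies in `c`. The remainder commutes with every `s_l`, so it lives in the `q × q` corner.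
There, degree one forces each nonzero entry `(b, b')` to satisfy `f b = f b' + 1`; as `f` omits a
value, this cyclic grading unrolls to a linear one and the remainder is nilpotent. Being also
ad-semisimple, it is zero (`isCartanSubspace_cartanC`).

Restricted roots: a root restricts to `t_k ω^i - t_l ω^j` with `k ≠ l`, to a nonzero multiple of one
`t_l`, or to zero (`hyperplane_cases`).

Lifts: the average `e^{(0)}` of `ε_i - ε_j` is a power `P^{j-i}` placed in block `(k, l)`
(`coe_e0`), so both exponentials are computed among block circulants. In case 2, `J = e^{(0)}_α -
e^{(0)}_{-α}` satisfies `J^3 = -J`, and `exp (π/2 J) = 1 + J^2 + J` exchanges the blocks `k` and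
`l`, so conjugation swaps `t_k` and `t_l` up to inverse powers of `ω`. In case 1, the Fourier basis
diagonalises the circulants of block `l`, and the Vandermonde system prescribes the eigenvalues so
that the exponential is a multiple of `P` on that block and the identity elsewhere; conjugation
multiplies `t_l` by `ω`. `expLiftsReflection_of_conj` turns either conjugation formula into the
required reflection. -/

theorem exp_sum_smul_of_orthogonal_idempotents {𝔸 κ : Type*} [NormedRing 𝔸] [NormedAlgebra ℂ 𝔸]
    [CompleteSpace 𝔸] [Fintype κ] [DecidableEq κ] (Q : κ → 𝔸) (c : κ → ℂ)
    (hQ : ∀ i j, Q i * Q j = if i = j then Q i else 0) :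
    NormedSpace.exp (∑ j, c j • Q j) = 1 + ∑ j, (Complex.exp (c j) - 1) • Q j := by
  have hpow : ∀ n : ℕ, (∑ j, c j • Q j) ^ (n + 1) = ∑ j, (c j) ^ (n + 1) • Q j := by
    intro n
    induction n with
    | zero => simp
    | succ n ih =>
      rw [pow_succ, ih, Finset.sum_mul_sum]
      refine Finset.sum_congr rfl fun i _ => ?_
      rw [Finset.sum_eq_single i]
      · rw [smul_mul_smul_comm, hQ, if_pos rfl, ← pow_succ]
      · intro j _ hj
        rw [smul_mul_smul_comm, hQ, if_neg (Ne.symm hj), smul_zero]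
      · simp
  have h1 := NormedSpace.exp_series_hasSum_exp' (𝕂 := ℂ) (∑ j, c j • Q j)
  have h2 : ∀ j, HasSum (fun n : ℕ => ((n.factorial : ℂ)⁻¹ * c j ^ n) • Q j)
      (Complex.exp (c j) • Q j) := by
    intro j
    have := NormedSpace.exp_series_hasSum_exp' (𝕂 := ℂ) (c j)
    rw [← Complex.exp_eq_exp_ℂ] at this
    simpa using this.smul_const (Q j)
  -- The idempotents need not sum to `1`, so only positive powers are computed termwise; the
  -- degree-zero term is corrected by `1 - ∑ Q j`.
  have h3 := (hasSum_sum fun j (_ : j ∈ Finset.univ) => h2 j).add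
    (hasSum_ite_eq 0 (1 - ∑ j, Q j))
  have h4 : (fun n : ℕ => ((n.factorial : ℂ)⁻¹) • (∑ j, c j • Q j) ^ n) =
      fun n : ℕ => (∑ j, ((n.factorial : ℂ)⁻¹ * c j ^ n) • Q j) +
        if n = 0 then 1 - ∑ j, Q j else 0 := by
    funext n
    cases n with
    | zero => simp
    | succ n => simp [hpow, Finset.smul_sum, smul_smul]
  rw [h4] at h1
  rw [h1.unique h3]
  simp only [sub_smul, one_smul, Finset.sum_sub_distrib]
  abel

variable {ι κ : Type*} [Fintype ι] [DecidableEq ι] [Fintype κ] [DecidableEq κ]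

theorem matrix_exp_sum_smul_of_orthogonal_idempotents (Q : κ → Matrix ι ι ℂ) (c : κ → ℂ)
    (hQ : ∀ i j, Q i * Q j = if i = j then Q i else 0) :
    NormedSpace.exp (∑ j, c j • Q j) = 1 + ∑ j, (Complex.exp (c j) - 1) • Q j := by
  -- The exponential depends only on the topology, so any submultiplicative norm inducing it may be
  -- installed locally.
  let : NormedRing (Matrix ι ι ℂ) := Matrix.linftyOpNormedRing
  let : NormedAlgebra ℂ (Matrix ι ι ℂ) := Matrix.linftyOpNormedAlgebra
  exact exp_sum_smul_of_orthogonal_idempotents Q c hQ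

theorem vecMulVec_mul_vecMulVec_of_dual {u v : κ → ι → ℂ}
    (huv : ∀ i j, v i ⬝ᵥ u j = if i = j then 1 else 0) (i j : κ) :
    Matrix.vecMulVec (u i) (v i) * Matrix.vecMulVec (u j) (v j) =
      if i = j then Matrix.vecMulVec (u i) (v i) else 0 := by
  rw [Matrix.vecMulVec_mul_vecMulVec, huv]
  split_ifs with h
  · simp [h]
  · simp

/-- Factor the sum as `A * B` with `A` carrying the scaled columns `u j` and `B` the rows `v j`.
Then `det (1 + AB) = det (1 + BA)`, and duality makes `BA` diagonal. -/
theorem det_one_add_sum_smul_vecMulVec {u v : κ → ι → ℂ}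
    (huv : ∀ i j, v i ⬝ᵥ u j = if i = j then 1 else 0) (c : κ → ℂ) :
    (1 + ∑ j, c j • Matrix.vecMulVec (u j) (v j)).det = ∏ j, (1 + c j) := by
  have h : ∑ j, c j • Matrix.vecMulVec (u j) (v j) =
      Matrix.of (fun p j => c j * u j p) * Matrix.of v := by
    ext p q
    simp [Matrix.sum_apply, Matrix.mul_apply, Matrix.vecMulVec_apply, mul_assoc]
  have h' : Matrix.of v * Matrix.of (fun p j => c j * u j p) = Matrix.diagonal c := by
    ext i j
    have := huv i j
    simp only [dotProduct] at this
    simp only [Matrix.mul_apply, Matrix.of_apply, Matrix.diagonal_apply]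
    simp only [mul_left_comm _ (c j), ← Finset.mul_sum, this]
    split_ifs with h
    · simp [h]
    · simp
  rw [h, Matrix.det_one_add_mul_comm, h', ← Matrix.diagonal_one, Matrix.diagonal_add,
    Matrix.det_diagonal]

theorem det_exp_sum_smul_vecMulVec {u v : κ → ι → ℂ}
    (huv : ∀ i j, v i ⬝ᵥ u j = if i = j then 1 else 0) (c : κ → ℂ) :
    (NormedSpace.exp (∑ j, c j • Matrix.vecMulVec (u j) (v j))).det =
      Complex.exp (∑ j, c j • Matrix.vecMulVec (u j) (v j)).trace := by
  rw [matrix_exp_sum_smul_of_orthogonal_idempotents _ _ (vecMulVec_mul_vecMulVec_of_dual huv),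
    det_one_add_sum_smul_vecMulVec huv]
  have : (∑ j, c j • Matrix.vecMulVec (u j) (v j)).trace = ∑ j, c j := by
    rw [Matrix.trace_sum]
    refine Finset.sum_congr rfl fun j _ => ?_
    rw [Matrix.trace_smul, Matrix.trace_vecMulVec, dotProduct_comm, huv, if_pos rfl]
    simp
  simp [this, Complex.exp_sum]

/-- For `J ^ 3 = -J`, the exponential of `(π / 2) J`. -/
theorem exp_pi_div_two_smul {J : Matrix ι ι ℂ} (hJ : J * J * J = -J) :
    NormedSpace.exp (((Real.pi : ℂ) / 2) • J) = 1 + J * J + J := by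
  have hJ4 : J * J * (J * J) = -(J * J) := by
    rw [← Matrix.mul_assoc, hJ, Matrix.neg_mul]
  have hJ3 : J * (J * J) = -J := by rw [← Matrix.mul_assoc, hJ]
  let e : Bool → ℂ := fun b => if b then Complex.I else -Complex.I
  -- The spectral projectors of `J` for the eigenvalues `±i`, obtained by interpolation on the roots
  -- `0, i, -i` of `X^3 + X`.
  let Q : Bool → Matrix ι ι ℂ := fun b => (-(1 / 2 : ℂ)) • (J * J + e b • J)
  have hQ : ∀ i j, Q i * Q j = if i = j then Q i else 0 := by
    intro i j
    have he : Q i * Q j = ((1 / 4 : ℂ) * (e i * e j - 1)) • (J * J) +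
        (-(1 / 4 : ℂ) * (e i + e j)) • J := by
      simp only [Q, smul_mul_smul_comm, Matrix.add_mul, Matrix.mul_add, Matrix.smul_mul,
        Matrix.mul_smul, hJ4, hJ, hJ3]
      module
    rw [he]
    cases i <;> cases j <;> simp only [e, Q] <;> simp <;> module
  have h := matrix_exp_sum_smul_of_orthogonal_idempotents Q
    (fun b => (Real.pi / 2 : ℂ) * e b) hQ
  have h1 : ∑ b, ((Real.pi / 2 : ℂ) * e b) • Q b = ((Real.pi : ℂ) / 2) • J := by
    simp only [Fintype.sum_bool, e, Q, if_true, Bool.false_eq_true, if_false]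
    simp only [smul_add, smul_smul]
    match_scalars
    · ring
    · linear_combination (-(Real.pi : ℂ) / 2) * Complex.I_mul_I
  rw [h1] at h
  rw [h]
  have e1 : Complex.exp ((Real.pi / 2 : ℂ) * Complex.I) = Complex.I := by
    exact Complex.exp_pi_div_two_mul_I
  have e2 : Complex.exp ((Real.pi / 2 : ℂ) * -Complex.I) = -Complex.I := by
    rw [mul_neg, Complex.exp_neg, e1, Complex.inv_I]
  simp only [Fintype.sum_bool, e, Q, if_true, Bool.false_eq_true, if_false, e1, e2]
  match_scalars
  · norm_num
  · ring
  · linear_combination (-1 : ℂ) * Complex.I_mul_I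

/-- The exponential of a skew matrix is orthogonal, which fixes its determinant only up to sign;
halving `X` first makes the determinant a square of such a sign. -/
theorem det_exp_eq_one_of_transpose_eq_neg {X : Matrix ι ι ℂ} (hX : X.transpose = -X) :
    (NormedSpace.exp X).det = 1 := by
  obtain ⟨Y, rfl, hY⟩ : ∃ Y : Matrix ι ι ℂ, X = (2 : ℕ) • Y ∧ Y.transpose = -Y :=
    ⟨(1 / 2 : ℂ) • X, by module, by rw [Matrix.transpose_smul, hX, smul_neg]⟩
  have h := congrArg Matrix.det (Matrix.exp_transpose Y)
  rw [hY, Matrix.det_transpose, Matrix.exp_neg] at h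
  have hu : IsUnit (NormedSpace.exp Y).det := (Matrix.isUnit_iff_isUnit_det _).1 (Matrix.isUnit_exp Y)
  have h3 := congrArg Matrix.det (Matrix.nonsing_inv_mul _ hu)
  rw [Matrix.det_mul, h, Matrix.det_one] at h3
  rw [Matrix.exp_nsmul, Matrix.det_pow, pow_two, h3]

end Exponential

/-! ### Semisimplicity of the adjoint action of diagonal matrices. -/

section Semisimple

variable {ι : Type*} [Fintype ι] [DecidableEq ι]

theorem sl_lie_diag_apply {x : sl ι ℂ} (hx : (x : Matrix ι ι ℂ).IsDiag) (y : sl ι ℂ) (i j : ι) :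
    ((⁅x, y⁆ : sl ι ℂ) : Matrix ι ι ℂ) i j =
      ((x : Matrix ι ι ℂ) i i - (x : Matrix ι ι ℂ) j j) * (y : Matrix ι ι ℂ) i j := by
  rw [sl_bracket]
  obtain ⟨d, hd⟩ : ∃ d, (x : Matrix ι ι ℂ) = Matrix.diagonal d :=
    ⟨_, hx.diagonal_diag.symm⟩
  rw [Matrix.sub_apply, hd, Matrix.diagonal_mul, Matrix.mul_diagonal, Matrix.diagonal_apply_eq,
    Matrix.diagonal_apply_eq]
  ring

/-- `ad x` scales the entry `(i, j)` by `x_ii - x_jj`, so it is annihilated by the product of `X -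
μ` over the distinct differences `μ`, which is squarefree. -/
theorem isSemisimple_ad_of_isDiag {x : sl ι ℂ} (hx : (x : Matrix ι ι ℂ).IsDiag) :
    (LieAlgebra.ad ℂ (sl ι ℂ) x).IsSemisimple := by
  classical
  let S : Finset ℂ := Finset.univ.image fun p : ι × ι =>
    (x : Matrix ι ι ℂ) p.1 p.1 - (x : Matrix ι ι ℂ) p.2 p.2
  let P : Polynomial ℂ := ∏ μ ∈ S, (Polynomial.X - Polynomial.C μ)
  refine Module.End.isSemisimple_of_squarefree_aeval_eq_zero (p := P) ?_ ?_
  · exact (Polynomial.separable_prod_X_sub_C_iff'.2 fun _ _ _ _ h => h).squarefree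
  · ext1 y
    apply Subtype.ext
    ext i j
    have key : ∀ p : Polynomial ℂ,
        ((Polynomial.aeval (LieAlgebra.ad ℂ (sl ι ℂ) x) p y : sl ι ℂ) : Matrix ι ι ℂ) i j =
        p.eval ((x : Matrix ι ι ℂ) i i - (x : Matrix ι ι ℂ) j j) * (y : Matrix ι ι ℂ) i j := by
      intro p
      induction p using Polynomial.induction_on' with
      | add p q hp hq => simp [add_mul, hp, hq]
      | monomial n a =>
        rw [Polynomial.aeval_monomial, Polynomial.eval_monomial]
        have : ∀ n : ℕ, ((((LieAlgebra.ad ℂ (sl ι ℂ) x) ^ n) y : sl ι ℂ) : Matrix ι ι ℂ) i j =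
            ((x : Matrix ι ι ℂ) i i - (x : Matrix ι ι ℂ) j j) ^ n * (y : Matrix ι ι ℂ) i j := by
          intro n
          induction n with
          | zero => simp
          | succ n ih =>
            rw [pow_succ', Module.End.mul_apply, LieAlgebra.ad_apply, sl_lie_diag_apply hx, ih]
            ring
        simp [Module.algebraMap_end_eq_smul_id, this, mul_assoc]
    rw [key, Polynomial.eval_prod, Finset.prod_eq_zero (i := (x : Matrix ι ι ℂ) i i -
      (x : Matrix ι ι ℂ) j j)]
    · simp
    · exact Finset.mem_image.2 ⟨(i, j), Finset.mem_univ _, rfl⟩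
    · simp

end Semisimple

/-! ### The grading in matrix entries, and coordinates on `c`. -/

section NormalForm

variable {m r q : ℕ} [NeZero m]

/-- The permutation of the standard basis that rotates every block. -/
def shift (m r q : ℕ) [NeZero m] : Equiv.Perm (Idx m r q) :=
  Equiv.sumCongr (Equiv.prodCongr (Equiv.refl _) (Equiv.addRight 1)) (Equiv.refl _)

/-- The nonzero entries of the grading matrix. -/
def weight (r : ℕ) (ω : ℂ) (f : Fin q → Fin m) : Idx m r q → ℂ :=
  Sum.elim (fun _ => 1) fun b => ω ^ (f b : ℕ)

@[simp] theorem shift_inl (l : Fin r) (a : Fin m) :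
    shift m r q (Sum.inl (l, a)) = Sum.inl (l, a + 1) := rfl

@[simp] theorem shift_inr (b : Fin q) : shift m r q (Sum.inr b) = Sum.inr b := rfl

@[simp] theorem weight_inl (ω : ℂ) (f : Fin q → Fin m) (p : Fin r × Fin m) :
    weight r ω f (Sum.inl p) = 1 := rfl

@[simp] theorem weight_inr (ω : ℂ) (f : Fin q → Fin m) (b : Fin q) :
    weight r ω f (Sum.inr b) = ω ^ (f b : ℕ) := rfl

theorem weight_ne_zero {ω : ℂ} (hω : IsPrimitiveRoot ω m) (f : Fin q → Fin m) (p : Idx m r q) :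
    weight r ω f p ≠ 0 := by
  rcases p with p | b
  · simp
  · simpa using fun h => absurd h (hω.ne_zero (NeZero.ne m))

theorem weight_shift (ω : ℂ) (f : Fin q → Fin m) (p : Idx m r q) :
    weight r ω f (shift m r q p) = weight r ω f p := by
  rcases p with p | b <;> rfl

theorem gradingMatrix_apply (ω : ℂ) (f : Fin q → Fin m) (p p' : Idx m r q) :
    gradingMatrix r ω f p p' = if p' = shift m r q p then weight r ω f p else 0 := by
  rcases p with ⟨l, a⟩ | b <;> rcases p' with ⟨l', a'⟩ | b'
  · simp only [gradingMatrix, Matrix.fromBlocks_apply₁₁, Matrix.kroneckerMap_apply, cyclicP,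
      Matrix.one_apply, Matrix.of_apply, shift_inl, Sum.inl.injEq, Prod.mk.injEq, weight_inl]
    by_cases h : l = l' <;> by_cases h' : a' = a + 1 <;> simp [h, h', eq_comm]
  · simp [gradingMatrix]
  · simp [gradingMatrix]
  · simp [gradingMatrix, Matrix.diagonal_apply, eq_comm]

/-- Compare entries in `θ(x) D = D x`; keeping the weight on the left avoids computing `D⁻¹`. -/
theorem theta_apply {ω : ℂ} (hω : IsPrimitiveRoot ω m) (f : Fin q → Fin m)
    (x : sl (Idx m r q) ℂ) (p p' : Idx m r q) :
    (theta r hω f x : Matrix (Idx m r q) (Idx m r q) ℂ) p p' * weight r ω f p' =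
      weight r ω f p * (x : Matrix (Idx m r q) (Idx m r q) ℂ) (shift m r q p) (shift m r q p') := by
  have h : (theta r hω f x : Matrix (Idx m r q) (Idx m r q) ℂ) * gradingMatrix r ω f =
      gradingMatrix r ω f * (x : Matrix (Idx m r q) (Idx m r q) ℂ) := by
    change gradingMatrix r ω f * (x : Matrix (Idx m r q) (Idx m r q) ℂ) * (gradingMatrix r ω f)⁻¹ *
      gradingMatrix r ω f = _
    rw [Matrix.mul_assoc, Matrix.nonsing_inv_mul _ (isUnit_det_gradingMatrix r hω f),
      Matrix.mul_one]
  have h' := congrFun (congrFun h p) (shift m r q p')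
  simpa [Matrix.mul_apply, gradingMatrix_apply, (shift m r q).injective.eq_iff] using h'

theorem theta_iterate_apply {ω : ℂ} (hω : IsPrimitiveRoot ω m) (f : Fin q → Fin m)
    (x : sl (Idx m r q) ℂ) (n : ℕ) (p p' : Idx m r q) :
    (((theta r hω f)^[n] x : sl (Idx m r q) ℂ) : Matrix (Idx m r q) (Idx m r q) ℂ) p p' * weight r ω f p' ^ n =
      weight r ω f p ^ n *
        (x : Matrix (Idx m r q) (Idx m r q) ℂ) ((shift m r q ^ n) p) ((shift m r q ^ n) p') := by
  induction n generalizing p p' with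
  | zero => simp
  | succ n ih =>
    rw [Function.iterate_succ_apply', pow_succ', pow_succ' (weight r ω f p), pow_succ,
      ← mul_assoc, theta_apply, mul_assoc, ← weight_shift (q := q) ω f p', ih, weight_shift,
      mul_assoc]
    rfl

theorem mem_gradedPiece_theta {ω : ℂ} (hω : IsPrimitiveRoot ω m) (f : Fin q → Fin m) (i : ℕ)
    (x : sl (Idx m r q) ℂ) :
    x ∈ gradedPiece (theta r hω f) ω i ↔ ∀ p p' : Idx m r q,
      weight r ω f p * (x : Matrix (Idx m r q) (Idx m r q) ℂ) (shift m r q p) (shift m r q p') =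
        ω ^ i * (x : Matrix (Idx m r q) (Idx m r q) ℂ) p p' * weight r ω f p' := by
  rw [gradedPiece, Module.End.mem_eigenspace_iff]
  constructor
  · intro h p p'
    rw [← theta_apply hω]
    congr 1
    exact congrFun (congrFun (congrArg Subtype.val h) p) p'
  · intro h
    apply Subtype.ext
    ext p p'
    refine mul_right_cancel₀ (weight_ne_zero hω f p') ?_
    exact (theta_apply hω f x p p').trans (h p p')

theorem shift_pow_inl (n : ℕ) (l : Fin r) (a : Fin m) :
    (shift m r q ^ n) (Sum.inl (l, a)) = Sum.inl (l, a + Fin.ofNat m n) := by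
  induction n with
  | zero => simp
  | succ n ih =>
    rw [pow_succ', Equiv.Perm.mul_apply, ih, shift_inl, add_assoc]
    congr 3
    apply Fin.ext
    simp [Fin.val_add]

theorem shift_pow_inr (n : ℕ) (b : Fin q) :
    (shift m r q ^ n) (Sum.inr b) = Sum.inr b := by
  induction n with
  | zero => simp
  | succ n ih => rw [pow_succ', Equiv.Perm.mul_apply, ih, shift_inr]

theorem pow_val_add {ω : ℂ} (hω : IsPrimitiveRoot ω m) (a b : Fin m) :
    ω ^ ((a + b : Fin m) : ℕ) = ω ^ (a : ℕ) * ω ^ (b : ℕ) := by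
  rw [Fin.val_add, ← pow_eq_pow_mod _ hω.pow_eq_one, pow_add]

theorem pow_val_one {ω : ℂ} (hω : IsPrimitiveRoot ω m) : ω ^ ((1 : Fin m) : ℕ) = ω := by
  rw [Fin.val_one', ← pow_eq_pow_mod _ hω.pow_eq_one, pow_one]

theorem pow_val_injective {ω : ℂ} (hω : IsPrimitiveRoot ω m) :
    Function.Injective fun a : Fin m => ω ^ (a : ℕ) :=
  fun a b h => Fin.ext (hω.pow_inj a.2 b.2 h)

/-! ### Coordinates on the Cartan subspace -/

/-- The element `∑ t_l s_l`. -/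
def cartanVec {ω : ℂ} (hω : IsPrimitiveRoot ω m) (hm : 1 < m) (q : ℕ) :
    (Fin r → ℂ) →ₗ[ℂ] sl (Idx m r q) ℂ :=
  Fintype.linearCombination ℂ (sVec hω hm q)

/-- The diagonal entries of `∑ t_l s_l`. -/
def cartanEntry (ω : ℂ) (t : Fin r → ℂ) : Idx m r q → ℂ :=
  Sum.elim (fun p => t p.1 * ω ^ (p.2 : ℕ)) fun _ => 0

@[simp] theorem cartanEntry_inl (ω : ℂ) (t : Fin r → ℂ) (l : Fin r) (a : Fin m) :
    cartanEntry (q := q) ω t (Sum.inl (l, a)) = t l * ω ^ (a : ℕ) := rfl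

@[simp] theorem cartanEntry_inr (ω : ℂ) (t : Fin r → ℂ) (b : Fin q) :
    cartanEntry (m := m) ω t (Sum.inr b) = 0 := rfl

theorem coe_cartanVec {ω : ℂ} (hω : IsPrimitiveRoot ω m) (hm : 1 < m) (t : Fin r → ℂ) :
    (cartanVec hω hm q t : Matrix (Idx m r q) (Idx m r q) ℂ) =
      Matrix.diagonal (cartanEntry ω t) := by
  ext p p'
  simp only [cartanVec, Fintype.linearCombination_apply]
  rw [AddSubmonoidClass.coe_finsetSum, Matrix.sum_apply]
  simp only [SetLike.val_smul, Matrix.smul_apply, sVec, Matrix.diagonal_apply]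
  split_ifs with h
  · rcases p with ⟨l, a⟩ | b <;> simp
  · simp

theorem cartanVec_injective {ω : ℂ} (hω : IsPrimitiveRoot ω m) (hm : 1 < m) :
    Function.Injective (cartanVec (r := r) hω hm q) := by
  intro t t' h
  have h' := congrArg Subtype.val h
  rw [coe_cartanVec, coe_cartanVec] at h'
  funext l
  simpa using congrFun (Matrix.diagonal_injective h') (Sum.inl (l, 0))

theorem cartanVec_single {ω : ℂ} (hω : IsPrimitiveRoot ω m) (hm : 1 < m) (l : Fin r) :
    cartanVec hω hm q (Pi.single l 1) = sVec hω hm q l := by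
  simp [cartanVec, Fintype.linearCombination_apply_single]

theorem diag_entry_of_mem_gradedPiece_one {ω : ℂ} (hω : IsPrimitiveRoot ω m) (f : Fin q → Fin m)
    {x : sl (Idx m r q) ℂ} (hx : x ∈ gradedPiece (theta r hω f) ω 1) (l : Fin r) (a : Fin m) :
    (x : Matrix (Idx m r q) (Idx m r q) ℂ) (Sum.inl (l, a)) (Sum.inl (l, a)) =
      (x : Matrix (Idx m r q) (Idx m r q) ℂ) (Sum.inl (l, 0)) (Sum.inl (l, 0)) * ω ^ (a : ℕ) := by
  rw [mem_gradedPiece_theta] at hx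
  obtain ⟨n, hn⟩ := a
  induction n with
  | zero => simp [show (⟨0, hn⟩ : Fin m) = 0 from rfl]
  | succ n ih =>
    have h := hx (Sum.inl (l, ⟨n, by omega⟩)) (Sum.inl (l, ⟨n, by omega⟩))
    have e : (⟨n, by omega⟩ + 1 : Fin m) = ⟨n + 1, hn⟩ := by
      apply Fin.ext
      simp [Fin.val_add, Nat.mod_eq_of_lt hn]
    rw [shift_inl, e, ih] at h
    simp only [weight_inl, one_mul, mul_one, pow_one] at h
    rw [h]
    simp only [pow_succ]
    ring

theorem cartanVec_mem_cartanC {ω : ℂ} (hω : IsPrimitiveRoot ω m) (hm : 1 < m)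
    (f : Fin q → Fin m) (t : Fin r → ℂ) : cartanVec hω hm q t ∈ cartanC r hω f := by
  refine ⟨?_, ?_⟩
  · change (cartanVec hω hm q t : Matrix (Idx m r q) (Idx m r q) ℂ).IsDiag
    rw [coe_cartanVec]
    exact Matrix.isDiag_diagonal _
  · change _ ∈ gradedPiece _ _ _
    rw [mem_gradedPiece_theta, coe_cartanVec]
    intro p p'
    simp only [Matrix.diagonal_apply, (shift m r q).injective.eq_iff]
    split_ifs with h
    · subst h
      rcases p with ⟨l, a⟩ | b
      · simp only [shift_inl, weight_inl, cartanEntry_inl, pow_val_add hω, pow_val_one hω]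
        ring
      · simp
    · simp

theorem exists_diagonal_eq_cartanEntry {ω : ℂ} (hω : IsPrimitiveRoot ω m) (hm : 1 < m)
    (f : Fin q → Fin m) {x : sl (Idx m r q) ℂ} (hx : x ∈ gradedPiece (theta r hω f) ω 1) :
    ∃ t : Fin r → ℂ, ∀ p, (x : Matrix (Idx m r q) (Idx m r q) ℂ) p p = cartanEntry ω t p := by
  refine ⟨fun l => (x : Matrix (Idx m r q) (Idx m r q) ℂ) (Sum.inl (l, 0)) (Sum.inl (l, 0)), fun p => ?_⟩
  rcases p with ⟨l, a⟩ | b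
  · exact diag_entry_of_mem_gradedPiece_one hω f hx l a
  · have h := (mem_gradedPiece_theta hω f 1 x).1 hx (Sum.inr b) (Sum.inr b)
    have h0 := weight_ne_zero (r := r) hω f (Sum.inr b)
    simp only [shift_inr, pow_one] at h
    -- `θ` fixes the diagonal entries of the last `q` positions, while degree one multiplies them by
    -- `ω ≠ 1`.
    have h1 : (1 - ω) * (x : Matrix (Idx m r q) (Idx m r q) ℂ) (Sum.inr b) (Sum.inr b) = 0 :=
      mul_left_cancel₀ h0 (by rw [mul_zero]; linear_combination h)
    rcases mul_eq_zero.1 h1 with h2 | h2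
    · exact absurd (sub_eq_zero.1 h2).symm (hω.ne_one hm)
    · simpa using h2

theorem range_cartanVec {ω : ℂ} (hω : IsPrimitiveRoot ω m) (hm : 1 < m) (f : Fin q → Fin m) :
    LinearMap.range (cartanVec hω hm q) = cartanC r hω f := by
  apply le_antisymm
  · rintro _ ⟨t, rfl⟩
    exact cartanVec_mem_cartanC hω hm f t
  · rintro x ⟨hd, hx⟩
    obtain ⟨t, ht⟩ := exists_diagonal_eq_cartanEntry hω hm f hx
    refine ⟨t, Subtype.ext ?_⟩
    rw [coe_cartanVec, ← Matrix.IsDiag.diagonal_diag hd]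
    congr 1
    funext p
    exact (ht p).symm

/-- The coordinates of the Cartan subspace with respect to the basis `s_1, …, s_r`. -/
def cartanEquiv {ω : ℂ} (hω : IsPrimitiveRoot ω m) (hm : 1 < m) (f : Fin q → Fin m) :
    (Fin r → ℂ) ≃ₗ[ℂ] cartanC r hω f :=
  (LinearEquiv.ofInjective _ (cartanVec_injective hω hm)).trans
    (LinearEquiv.ofEq _ _ (range_cartanVec hω hm f))

theorem linearIndependent_sVec {ω : ℂ} (hω : IsPrimitiveRoot ω m) (hm : 1 < m) :
    LinearIndependent ℂ (sVec hω hm q : Fin r → _) := by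
  rw [linearIndependent_iff_injective_fintypeLinearCombination]
  exact cartanVec_injective hω hm

theorem span_sVec {ω : ℂ} (hω : IsPrimitiveRoot ω m) (hm : 1 < m) (f : Fin q → Fin m) :
    Submodule.span ℂ (Set.range (sVec hω hm q : Fin r → _)) = cartanC r hω f := by
  rw [← range_cartanVec hω hm f, cartanVec, Fintype.range_linearCombination]

theorem mem_hyperplaneOne {ω : ℂ} (hω : IsPrimitiveRoot ω m) (hm : 1 < m) (l : Fin r)
    (x : sl (Idx m r q) ℂ) :
    x ∈ hyperplaneOne hω hm q l ↔ ∃ t : Fin r → ℂ, t l = 0 ∧ cartanVec hω hm q t = x := by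
  constructor
  · intro hx
    let S : Submodule ℂ (sl (Idx m r q) ℂ) :=
      (LinearMap.ker (LinearMap.proj (R := ℂ) (φ := fun _ : Fin r => ℂ) l)).map
        (cartanVec hω hm q)
    have : hyperplaneOne hω hm q l ≤ S := by
      refine Submodule.span_le.2 ?_
      rintro _ ⟨a, ha, rfl⟩
      exact ⟨Pi.single a 1, Pi.single_eq_of_ne (M := fun _ => ℂ) (Ne.symm ha) 1,
        cartanVec_single hω hm a⟩
    obtain ⟨t, ht, rfl⟩ := this hx
    exact ⟨t, ht, rfl⟩
  · rintro ⟨t, ht, rfl⟩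
    rw [cartanVec, Fintype.linearCombination_apply]
    refine Submodule.sum_mem _ fun a _ => ?_
    by_cases h : a = l
    · rw [h, ht, zero_smul]
      exact zero_mem _
    · exact Submodule.smul_mem _ _ (Submodule.subset_span ⟨a, h, rfl⟩)

theorem mem_hyperplaneTwo {ω : ℂ} (hω : IsPrimitiveRoot ω m) (hm : 1 < m) {k l : Fin r}
    (hkl : k ≠ l) (i j : Fin m) (x : sl (Idx m r q) ℂ) :
    x ∈ hyperplaneTwo hω hm q k l i j ↔ ∃ t : Fin r → ℂ,
      t k * ω ^ (i : ℕ) = t l * ω ^ (j : ℕ) ∧ cartanVec hω hm q t = x := by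
  have h0 : ω ≠ 0 := hω.ne_zero (NeZero.ne m)
  constructor
  · intro hx
    let S : Submodule ℂ (sl (Idx m r q) ℂ) :=
      (LinearMap.ker (ω ^ (i : ℕ) • LinearMap.proj (R := ℂ) (φ := fun _ : Fin r => ℂ) k -
        ω ^ (j : ℕ) • LinearMap.proj (R := ℂ) (φ := fun _ : Fin r => ℂ) l)).map
        (cartanVec hω hm q)
    have : hyperplaneTwo hω hm q k l i j ≤ S := by
      refine Submodule.span_le.2 (Set.insert_subset ?_ ?_)
      -- For this generator both sides of the equation equal `ω⁻¹`: the shift to positions counted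
      -- from `1` is common to both and harmless.
      · refine ⟨(ω ^ ((i : ℕ) + 1))⁻¹ • Pi.single k 1 + (ω ^ ((j : ℕ) + 1))⁻¹ • Pi.single l 1,
          ?_, by simp [cartanVec_single]⟩
        simp [hkl, hkl.symm]
        field_simp
        ring
      · rintro _ ⟨a, ha, rfl⟩
        refine ⟨Pi.single a 1, ?_, cartanVec_single hω hm a⟩
        have h1 : (Pi.single a 1 : Fin r → ℂ) k = 0 := Pi.single_eq_of_ne (Ne.symm ha.1) 1
        have h2 : (Pi.single a 1 : Fin r → ℂ) l = 0 := Pi.single_eq_of_ne (Ne.symm ha.2) 1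
        change ω ^ (i : ℕ) * (Pi.single a 1 : Fin r → ℂ) k -
          ω ^ (j : ℕ) * (Pi.single a 1 : Fin r → ℂ) l = 0
        rw [h1, h2, mul_zero, mul_zero, sub_zero]
    obtain ⟨t, ht, rfl⟩ := this hx
    refine ⟨t, ?_, rfl⟩
    have : ω ^ (i : ℕ) * t k - ω ^ (j : ℕ) * t l = 0 := by simpa using ht
    linear_combination this
  · rintro ⟨t, ht, rfl⟩
    have hsum : cartanVec hω hm q t = (t k * ω ^ ((i : ℕ) + 1)) •
        ((ω ^ ((i : ℕ) + 1))⁻¹ • sVec hω hm q k + (ω ^ ((j : ℕ) + 1))⁻¹ • sVec hω hm q l) +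
        ∑ a ∈ (Finset.univ.erase k).erase l, t a • sVec hω hm q a := by
      rw [cartanVec, Fintype.linearCombination_apply,
        ← Finset.add_sum_erase _ _ (Finset.mem_univ k),
        ← Finset.add_sum_erase _ _ (Finset.mem_erase.2 ⟨hkl.symm, Finset.mem_univ l⟩),
        ← add_assoc, smul_add, smul_smul, smul_smul]
      congr 3
      · field_simp
      · rw [pow_succ, ← mul_assoc, ht]
        field_simp
        ring
    rw [hsum]
    refine add_mem (Submodule.smul_mem _ _ (Submodule.subset_span (Set.mem_insert _ _)))
      (Submodule.sum_mem _ fun a ha => Submodule.smul_mem _ _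
        (Submodule.subset_span (Set.mem_insert_of_mem _ ⟨a, ?_, rfl⟩)))
    simp only [Finset.mem_erase] at ha
    exact ⟨ha.2.1, ha.1⟩

end NormalForm

/-! ### Roots of the diagonal subalgebra, and maximality of `c`. -/

section Roots

/-- A nonzero entry of `M ^ n` needs a difference of exactly `n` in grade, impossible for `n = N`.
-/
theorem pow_eq_zero_of_strictly_graded {ι R : Type*} [Fintype ι] [DecidableEq ι] [Semiring R]
    {M : Matrix ι ι R} {g : ι → ℕ} {N : ℕ} (hg : ∀ p, g p < N)
    (hM : ∀ p p', M p p' ≠ 0 → g p = g p' + 1) : M ^ N = 0 := by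
  have h : ∀ n p p', (M ^ n) p p' ≠ 0 → g p = g p' + n := by
    intro n
    induction n with
    | zero =>
      intro p p' h
      rw [pow_zero, Matrix.one_apply] at h
      split_ifs at h with e
      · simp [e]
      · exact absurd rfl h
    | succ n ih =>
      intro p p' h
      rw [pow_succ, Matrix.mul_apply] at h
      obtain ⟨s, -, hs⟩ := Finset.exists_ne_zero_of_sum_ne_zero h
      have h1 := ih p s (left_ne_zero_of_mul hs)
      have h2 := hM s p' (right_ne_zero_of_mul hs)
      omega
  ext p p'
  by_contra hne
  have h1 := h N p p' hne
  have h2 := hg p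
  omega

variable {ι : Type*} [Fintype ι] [DecidableEq ι]

theorem epsDiff_apply (i j : ι) (x : diagCartan ι) :
    epsDiff i j x = ((x : sl ι ℂ) : Matrix ι ι ℂ) i i - ((x : sl ι ℂ) : Matrix ι ι ℂ) j j := rfl

/-- One nonzero entry `(i, j)` of a root vector already determines the root, since `ad x` acts on
that entry by `ε_i - ε_j`. -/
theorem exists_eq_epsDiff_of_mem_roots {β : Module.Dual ℂ (diagCartan ι)}
    (hβ : β ∈ roots (diagCartan ι)) : ∃ i j, i ≠ j ∧ β = epsDiff i j := by
  obtain ⟨h0, y, hy, hxy⟩ := hβ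
  have key : ∀ (x : diagCartan ι) i j, (epsDiff i j x - β x) * (y : Matrix ι ι ℂ) i j = 0 := by
    intro x i j
    have h := congrFun (congrFun (congrArg Subtype.val (hxy x)) i) j
    rw [sl_lie_diag_apply x.2, SetLike.val_smul, Matrix.smul_apply, smul_eq_mul,
      ← epsDiff_apply] at h
    linear_combination h
  obtain ⟨i, j, hij⟩ : ∃ i j, (y : Matrix ι ι ℂ) i j ≠ 0 := by
    by_contra! h
    exact hy (Subtype.ext (Matrix.ext h))
  have hβ : β = epsDiff i j := by
    ext x
    rcases mul_eq_zero.1 (key x i j) with h | h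
    · exact (sub_eq_zero.1 h).symm
    · exact absurd h hij
  refine ⟨i, j, ?_, hβ⟩
  rintro rfl
  refine h0 (hβ.trans ?_)
  ext x
  simp [epsDiff_apply]

theorem eq_of_epsDiff_eq {p p' s s' : ι} (hp : p ≠ p')
    (h : epsDiff p p' = epsDiff s s') : p = s := by
  by_contra hne
  -- On `E_pp - E_p'p'` the form `ε_p - ε_p'` takes the value `2`, which `ε_s - ε_s'` cannot reach
  -- when `s ≠ p`.
  let x : diagCartan ι := ⟨singleSubSingle p p' 1, by
    change (Matrix.single p p (1 : ℂ) - Matrix.single p' p' 1).IsDiag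
    refine Matrix.IsDiag.sub ?_ ?_ <;> rw [← Matrix.diagonal_single] <;>
      exact Matrix.isDiag_diagonal _⟩
  have hx := LinearMap.congr_fun h x
  simp only [epsDiff_apply, x, val_singleSubSingle, Matrix.sub_apply, Matrix.single_apply] at hx
  simp only [and_self, hp, hp.symm, hne, if_true, if_false] at hx
  split_ifs at hx <;> norm_num at hx

variable {m r q : ℕ} [NeZero m]

/-- The element `s_l` separates each position of block `l` from every other position, so a matrix
commuting with `s_l` has no off-diagonal entries in the rows and columns of that block. -/
theorem cartanEntry_single_ne {ω : ℂ} (hω : IsPrimitiveRoot ω m) (l : Fin r) (a : Fin m)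
    {p : Idx m r q} (hp : Sum.inl (l, a) ≠ p) :
    cartanEntry (q := q) ω (Pi.single l 1) (Sum.inl (l, a)) ≠ cartanEntry ω (Pi.single l 1) p := by
  have h0 : ω ≠ 0 := hω.ne_zero (NeZero.ne m)
  rcases p with ⟨l', a'⟩ | b
  · by_cases h : l' = l
    · subst h
      simp only [cartanEntry_inl, Pi.single_eq_same, one_mul]
      exact fun h => hp (by rw [pow_val_injective hω h])
    · simp [Pi.single_eq_of_ne h, h0]
  · simp [h0]

theorem isToralSubspace_cartanC {ω : ℂ} (hω : IsPrimitiveRoot ω m) (f : Fin q → Fin m) :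
    IsToralSubspace (theta r hω f) ω (cartanC r hω f) := by
  refine ⟨inf_le_right, fun x hx y hy => ?_, fun x hx => isSemisimple_ad_of_isDiag hx.1⟩
  apply Subtype.ext
  ext i j
  rw [sl_lie_diag_apply hx.1]
  by_cases h : i = j
  · simp [h]
  · have : (y : Matrix (Idx m r q) (Idx m r q) ℂ) i j = 0 := hy.1 h
    simp [this]

theorem isCartanSubspace_cartanC (hm : 1 < m) (hr : 1 ≤ r) {ω : ℂ} (hω : IsPrimitiveRoot ω m)
    (f : Fin q → Fin m) (hf : ¬ Function.Surjective f) :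
    IsCartanSubspace (theta r hω f) ω (cartanC r hω f) := by
  refine ⟨isToralSubspace_cartanC hω f, fun U hU hcU x hxU => ?_⟩
  obtain ⟨t, ht⟩ := exists_diagonal_eq_cartanEntry hω hm f (hU.1 hxU)
  have hdU : cartanVec hω hm q t ∈ cartanC r hω f := cartanVec_mem_cartanC hω hm f t
  obtain ⟨y, hy⟩ : ∃ y, y = x - cartanVec hω hm q t := ⟨_, rfl⟩
  have hyU : y ∈ U := hy ▸ sub_mem hxU (hcU hdU)
  suffices hy0 : y = 0 by
    rw [sub_eq_zero.1 (hy.symm.trans hy0)]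
    exact hdU
  have hdiag : ∀ p, (y : Matrix (Idx m r q) (Idx m r q) ℂ) p p = 0 := by
    intro p
    rw [hy, AddSubgroupClass.coe_sub, Matrix.sub_apply, coe_cartanVec, ht,
      Matrix.diagonal_apply_eq, sub_self]
  have hcomm : ∀ t p p', (cartanEntry ω t p - cartanEntry ω t p') *
      (y : Matrix (Idx m r q) (Idx m r q) ℂ) p p' = 0 := by
    intro t p p'
    have hc := cartanVec_mem_cartanC (r := r) hω hm f t
    have h := congrFun (congrFun (congrArg Subtype.val (hU.2.1 _ (hcU hc) _ hyU)) p) p'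
    rw [sl_lie_diag_apply hc.1, coe_cartanVec] at h
    simpa using h
  have hleft : ∀ l a p, (y : Matrix (Idx m r q) (Idx m r q) ℂ) (Sum.inl (l, a)) p = 0 := by
    intro l a p
    by_cases h : Sum.inl (l, a) = p
    · rw [h, hdiag]
    · exact (mul_eq_zero.1 (hcomm (Pi.single l 1) _ _)).resolve_left
        (sub_ne_zero.2 (cartanEntry_single_ne hω l a h))
  have hright : ∀ l a p, (y : Matrix (Idx m r q) (Idx m r q) ℂ) p (Sum.inl (l, a)) = 0 := by
    intro l a p
    by_cases h : Sum.inl (l, a) = p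
    · rw [h, hdiag]
    · exact (mul_eq_zero.1 (hcomm (Pi.single l 1) _ _)).resolve_left
        (sub_ne_zero.2 (cartanEntry_single_ne hω l a h).symm)
  obtain ⟨c, hc⟩ : ∃ c, ∀ b, f b ≠ c := by
    simpa [Function.Surjective] using hf
  have hnil : IsNilpotent (y : Matrix (Idx m r q) (Idx m r q) ℂ) := by
    -- Measuring exponents from the omitted value `c` turns the cyclic relation `f b = f b' + 1`
    -- into a strict grading by integers below `m`.
    refine ⟨m, pow_eq_zero_of_strictly_graded
      (g := Sum.elim (fun _ => 0) fun b => ((f b - c : Fin m) : ℕ)) ?_ ?_⟩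
    · rintro (p | b)
      · exact NeZero.pos m
      · exact Fin.is_lt _
    · rintro (⟨l, a⟩ | b) (⟨l', a'⟩ | b') h
      · exact absurd (hleft _ _ _) h
      · exact absurd (hleft _ _ _) h
      · exact absurd (hright _ _ _) h
      · have h1 := (mem_gradedPiece_theta hω f 1 y).1 (hU.1 hyU) (Sum.inr b) (Sum.inr b')
        simp only [shift_inr, weight_inr, pow_one] at h1
        have h2 : ω ^ (f b : ℕ) = ω ^ ((f b' + 1 : Fin m) : ℕ) := by
          rw [pow_val_add hω, pow_val_one hω]
          exact mul_right_cancel₀ h (by linear_combination h1)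
        have h3 : f b = f b' + 1 := pow_val_injective hω h2
        have h4 : f b - c = (f b' - c) + 1 := by rw [h3]; abel
        -- Wrapping around from `m - 1` to `0` would mean `f b = c`, which is excluded.
        have h5 : ((f b - c : Fin m) : ℕ) ≠ 0 := fun h0 =>
          hc b (sub_eq_zero.1 (Fin.ext (by simpa using h0)))
        simp only [Sum.elim_inr]
        rw [h4, Fin.val_add, Fin.val_one'] at h5 ⊢
        rw [Nat.mod_eq_of_lt hm] at h5 ⊢
        have h6 := (f b' - c).is_lt
        rcases Nat.lt_or_ge (((f b' - c : Fin m) : ℕ) + 1) m with h7 | h7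
        · exact Nat.mod_eq_of_lt h7
        · have h8 : ((f b' - c : Fin m) : ℕ) + 1 = m := by omega
          exact absurd (by rw [h8, Nat.mod_self]) h5
  have had : LieAlgebra.ad ℂ (sl (Idx m r q) ℂ) y = 0 :=
    Module.End.eq_zero_of_isNilpotent_isSemisimple
      (LieAlgebra.isNilpotent_ad_of_isNilpotent hnil) (hU.2.2 y hyU)
  apply Subtype.ext
  ext p p'
  rcases p' with ⟨l, a⟩ | b'
  · exact hright _ _ _
  -- With `z` in a block, the row `z` of `y` vanishes, so column `z` of `⁅y, E_{b'z}⁆` is exactly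
  -- column `b'` of `y`. This is where `1 ≤ r` enters.
  · let z : Idx m r q := Sum.inl (⟨0, hr⟩, 0)
    have hz : Sum.inr b' ≠ z := Sum.inr_ne_inl
    have h := congrFun (congrFun (congrArg Subtype.val
      (LinearMap.congr_fun had (single (Sum.inr b') z hz 1))) p) z
    rw [LieAlgebra.ad_apply, sl_bracket, Matrix.sub_apply, val_single,
      Matrix.mul_single_apply_same] at h
    have h' : (Matrix.single (Sum.inr b') z (1 : ℂ) *
        (y : Matrix (Idx m r q) (Idx m r q) ℂ)) p z = 0 := by
      rw [Matrix.mul_apply]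
      refine Finset.sum_eq_zero fun s _ => ?_
      rw [hright, mul_zero]
    rw [h', sub_zero, mul_one] at h
    exact h

end Roots

/-! ### Classification of the restricted roots, and the criterion for lifting a reflection. -/

section RestrictedRoots

variable {m r q : ℕ} [NeZero m]

theorem mem_hyperplane_iff {ω : ℂ} (hω : IsPrimitiveRoot ω m) (hm : 1 < m) (f : Fin q → Fin m)
    (σ : Module.Dual ℂ (cartanC r hω f)) (x : sl (Idx m r q) ℂ) :
    x ∈ hyperplane σ ↔
      ∃ t : Fin r → ℂ, σ (cartanEquiv hω hm f t) = 0 ∧ cartanVec hω hm q t = x := by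
  constructor
  · rintro ⟨y, hy, rfl⟩
    obtain ⟨t, rfl⟩ := (cartanEquiv hω hm f).surjective y
    exact ⟨t, hy, rfl⟩
  · rintro ⟨t, ht, rfl⟩
    exact ⟨_, ht, rfl⟩

theorem cartanVec_mem_hyperplaneOne {ω : ℂ} (hω : IsPrimitiveRoot ω m) (hm : 1 < m) (l : Fin r)
    (t : Fin r → ℂ) : cartanVec hω hm q t ∈ hyperplaneOne hω hm q l ↔ t l = 0 := by
  rw [mem_hyperplaneOne]
  constructor
  · rintro ⟨t', h, h'⟩
    rwa [← cartanVec_injective hω hm h']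
  · exact fun h => ⟨t, h, rfl⟩

theorem cartanVec_mem_hyperplaneTwo {ω : ℂ} (hω : IsPrimitiveRoot ω m) (hm : 1 < m)
    {k l : Fin r} (hkl : k ≠ l) (i j : Fin m) (t : Fin r → ℂ) :
    cartanVec hω hm q t ∈ hyperplaneTwo hω hm q k l i j ↔
      t k * ω ^ (i : ℕ) = t l * ω ^ (j : ℕ) := by
  rw [mem_hyperplaneTwo hω hm hkl]
  constructor
  · rintro ⟨t', h, h'⟩
    rwa [← cartanVec_injective hω hm h']
  · exact fun h => ⟨t, h, rfl⟩

/-- One of `s_k`, `s_l` has index different from `l₀`; it lies in the first hyperplane but not in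
the second. -/
theorem hyperplaneOne_ne_hyperplaneTwo {ω : ℂ} (hω : IsPrimitiveRoot ω m) (hm : 1 < m)
    (l₀ : Fin r) {k l : Fin r} (hkl : k ≠ l) (i j : Fin m) :
    hyperplaneOne hω hm q l₀ ≠ hyperplaneTwo hω hm q k l i j := by
  have h0 : ω ≠ 0 := hω.ne_zero (NeZero.ne m)
  intro h
  have key : ∀ t : Fin r → ℂ, t l₀ = 0 ↔ t k * ω ^ (i : ℕ) = t l * ω ^ (j : ℕ) := fun t => by
    rw [← cartanVec_mem_hyperplaneOne (q := q) hω hm, h, cartanVec_mem_hyperplaneTwo hω hm hkl]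
  by_cases h1 : k = l₀
  · have := (key (Pi.single l 1)).1 (Pi.single_eq_of_ne (h1 ▸ hkl) 1)
    rw [Pi.single_eq_of_ne hkl] at this
    simp only [Pi.single_eq_same, zero_mul, one_mul] at this
    exact pow_ne_zero _ h0 this.symm
  · have := (key (Pi.single k 1)).1 (Pi.single_eq_of_ne (Ne.symm h1) 1)
    rw [Pi.single_eq_of_ne hkl.symm] at this
    simp [h0] at this

theorem hyperplane_eq_hyperplaneOne {ω : ℂ} (hω : IsPrimitiveRoot ω m) (hm : 1 < m)
    (f : Fin q → Fin m) (σ : Module.Dual ℂ (cartanC r hω f)) (l : Fin r) {c : ℂ} (hc : c ≠ 0)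
    (h : ∀ t, σ (cartanEquiv hω hm f t) = c * t l) : hyperplane σ = hyperplaneOne hω hm q l := by
  ext x
  rw [mem_hyperplane_iff hω hm, mem_hyperplaneOne]
  simp only [h, mul_eq_zero, hc, false_or]

theorem hyperplane_eq_hyperplaneTwo {ω : ℂ} (hω : IsPrimitiveRoot ω m) (hm : 1 < m)
    (f : Fin q → Fin m) (σ : Module.Dual ℂ (cartanC r hω f)) {k l : Fin r} (hkl : k ≠ l)
    (i j : Fin m) {c : ℂ} (hc : c ≠ 0)
    (h : ∀ t, σ (cartanEquiv hω hm f t) = c * (t k * ω ^ (i : ℕ) - t l * ω ^ (j : ℕ))) :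
    hyperplane σ = hyperplaneTwo hω hm q k l i j := by
  ext x
  rw [mem_hyperplane_iff hω hm, mem_hyperplaneTwo hω hm hkl]
  simp only [h, mul_eq_zero, hc, false_or, sub_eq_zero]

theorem exists_cartanEntry_sub_of_mem_sigmaSet {ω : ℂ} (hω : IsPrimitiveRoot ω m) (hm : 1 < m)
    (f : Fin q → Fin m) {σ : Module.Dual ℂ (cartanC r hω f)} (hσ : σ ∈ sigmaSet r hω f) :
    ∃ p p' : Idx m r q, p ≠ p' ∧ ∀ t, σ (cartanEquiv hω hm f t) =
      cartanEntry ω t p - cartanEntry ω t p' := by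
  obtain ⟨-, β, hβ, rfl⟩ := hσ
  obtain ⟨p, p', hp, rfl⟩ := exists_eq_epsDiff_of_mem_roots hβ
  refine ⟨p, p', hp, fun t => ?_⟩
  rw [LinearMap.comp_apply, epsDiff_apply]
  change (cartanVec hω hm q t : Matrix (Idx m r q) (Idx m r q) ℂ) p p -
    (cartanVec hω hm q t : Matrix (Idx m r q) (Idx m r q) ℂ) p' p' = _
  rw [coe_cartanVec, Matrix.diagonal_apply_eq, Matrix.diagonal_apply_eq]

theorem hyperplane_cases {ω : ℂ} (hω : IsPrimitiveRoot ω m) (hm : 1 < m)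
    (f : Fin q → Fin m) {σ : Module.Dual ℂ (cartanC r hω f)} (hσ : σ ∈ sigmaSet r hω f) :
    (∃ l : Fin r, hyperplane σ = hyperplaneOne hω hm q l) ∨
      ∃ k l : Fin r, k < l ∧ ∃ i j : Fin m,
        hyperplane σ = hyperplaneTwo hω hm q k l i j := by
  have h0 : ω ≠ 0 := hω.ne_zero (NeZero.ne m)
  obtain ⟨p, p', hp, h⟩ := exists_cartanEntry_sub_of_mem_sigmaSet hω hm f hσ
  rcases p with ⟨k, i⟩ | b <;> rcases p' with ⟨l, j⟩ | b'
  · simp only [cartanEntry_inl] at h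
    rcases lt_trichotomy k l with hkl | rfl | hkl
    · exact Or.inr ⟨k, l, hkl, i, j, hyperplane_eq_hyperplaneTwo hω hm f σ hkl.ne i j one_ne_zero
        fun t => by rw [h, one_mul]⟩
    · refine Or.inl ⟨k, hyperplane_eq_hyperplaneOne hω hm f σ k
        (c := ω ^ (i : ℕ) - ω ^ (j : ℕ)) (sub_ne_zero.2 fun e => hp ?_) fun t => ?_⟩
      · rw [pow_val_injective hω e]
      · rw [h]; ring
    · exact Or.inr ⟨l, k, hkl, j, i, hyperplane_eq_hyperplaneTwo hω hm f σ hkl.ne j i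
        (neg_ne_zero.2 one_ne_zero) fun t => by rw [h]; ring⟩
  · refine Or.inl ⟨k, hyperplane_eq_hyperplaneOne hω hm f σ k (c := ω ^ (i : ℕ))
      (pow_ne_zero _ h0) fun t => ?_⟩
    rw [h, cartanEntry_inl, cartanEntry_inr, sub_zero, mul_comm]
  · refine Or.inl ⟨l, hyperplane_eq_hyperplaneOne hω hm f σ l (c := -ω ^ (j : ℕ))
      (neg_ne_zero.2 (pow_ne_zero _ h0)) fun t => ?_⟩
    rw [h, cartanEntry_inl, cartanEntry_inr, zero_sub, mul_comm, neg_mul]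
  -- A difference of two of the last `q` positions restricts to zero on `c`.
  · refine absurd (LinearMap.ext fun x => ?_) hσ.1
    obtain ⟨t, rfl⟩ := (cartanEquiv hω hm f).surjective x
    rw [h, cartanEntry_inr, cartanEntry_inr, sub_zero, LinearMap.zero_apply]

theorem hyperplane_xor {ω : ℂ} (hω : IsPrimitiveRoot ω m) (hm : 1 < m)
    (f : Fin q → Fin m) {σ : Module.Dual ℂ (cartanC r hω f)} (hσ : σ ∈ sigmaSet r hω f) :
    Xor (∃ l : Fin r, hyperplane σ = hyperplaneOne hω hm q l)
      (∃ k l : Fin r, k < l ∧ ∃ i j : Fin m,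
        hyperplane σ = hyperplaneTwo hω hm q k l i j) := by
  have hne : ¬ ((∃ l : Fin r, hyperplane σ = hyperplaneOne hω hm q l) ∧
      ∃ k l : Fin r, k < l ∧ ∃ i j : Fin m,
        hyperplane σ = hyperplaneTwo hω hm q k l i j) := by
    rintro ⟨⟨l₀, h⟩, k, l, hkl, i, j, h'⟩
    exact hyperplaneOne_ne_hyperplaneTwo hω hm l₀ hkl.ne i j (h.symm.trans h')
  rcases hyperplane_cases hω hm f hσ with h | h
  · exact Or.inl ⟨h, fun h' => hne ⟨h, h'⟩⟩
  · exact Or.inr ⟨h, fun h' => hne ⟨h', h⟩⟩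

/-- The common end of both cases: it suffices to know the conjugation by `exp X` in coordinates.
Finite order transports from `φ`, and the fixed space has codimension one because it is the kernel
of the nonzero form `σ`. -/
theorem expLiftsReflection_of_conj {ω : ℂ} (hω : IsPrimitiveRoot ω m) (hm : 1 < m)
    (f : Fin q → Fin m) {σ : Module.Dual ℂ (cartanC r hω f)} (hσ : σ ≠ 0)
    {X : sl (Idx m r q) ℂ} (hX : X ∈ gradedPiece (theta r hω f) ω 0)
    (hdet : (NormedSpace.exp (X : Matrix (Idx m r q) (Idx m r q) ℂ)).det = 1)
    (φ : (Fin r → ℂ) ≃ₗ[ℂ] (Fin r → ℂ)) (hφ : IsOfFinOrder φ)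
    (hconj : ∀ t, NormedSpace.exp (X : Matrix (Idx m r q) (Idx m r q) ℂ) *
        Matrix.diagonal (cartanEntry ω t) =
      Matrix.diagonal (cartanEntry ω (φ t)) *
        NormedSpace.exp (X : Matrix (Idx m r q) (Idx m r q) ℂ))
    (hfix : ∀ t, φ t = t ↔ cartanVec hω hm q t ∈ hyperplane σ) :
    ExpLiftsReflection (theta r hω f) ω σ X := by
  let g : Matrix.SpecialLinearGroup (Idx m r q) ℂ := ⟨NormedSpace.exp X, hdet⟩
  have hg : g ∈ G0 (theta r hω f) ω := Subgroup.subset_closure ⟨X, hX, rfl⟩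
  let e := cartanEquiv (r := r) hω hm f
  let s : cartanC r hω f ≃ₗ[ℂ] cartanC r hω f := (e.symm.trans φ).trans e
  have hs : ∀ t, s (e t) = e (φ t) := fun t => by simp [s]
  have hAd : AdRestrictsTo g s := by
    intro x
    obtain ⟨t, rfl⟩ := e.surjective x
    rw [hs]
    change (cartanVec hω hm q (φ t) : Matrix (Idx m r q) (Idx m r q) ℂ) =
      (g : Matrix (Idx m r q) (Idx m r q) ℂ) * (cartanVec hω hm q t : Matrix _ _ ℂ) * _
    rw [coe_cartanVec, coe_cartanVec]
    change _ = NormedSpace.exp (X : Matrix (Idx m r q) (Idx m r q) ℂ) * _ * _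
    rw [hconj]
    change _ = _ * (g : Matrix (Idx m r q) (Idx m r q) ℂ) * _
    rw [Matrix.mul_assoc, ← Matrix.SpecialLinearGroup.coe_mul, mul_inv_cancel,
      Matrix.SpecialLinearGroup.coe_one, Matrix.mul_one]
  have hfixed : fixedSpace s = hyperplane σ := by
    ext x
    rw [mem_hyperplane_iff hω hm]
    constructor
    · rintro ⟨y, hy, rfl⟩
      obtain ⟨t, rfl⟩ := e.surjective y
      have h1 : s (e t) = e t := sub_eq_zero.1 hy
      rw [hs] at h1
      obtain ⟨t', h2, h3⟩ := (mem_hyperplane_iff hω hm f σ _).1 ((hfix t).1 (e.injective h1))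
      exact ⟨t', h2, h3⟩
    · rintro ⟨t, ht, rfl⟩
      refine ⟨e t, sub_eq_zero.2 ?_, rfl⟩
      change s (e t) = e t
      rw [hs, (hfix t).2 ((mem_hyperplane_iff hω hm f σ _).2 ⟨t, ht, rfl⟩)]
  refine ⟨g, hg, rfl, s, ⟨g, hg, hAd⟩, hAd, ⟨?_, ?_⟩, hfixed⟩
  · obtain ⟨n, hn, hpow⟩ := isOfFinOrder_iff_pow_eq_one.1 hφ
    refine isOfFinOrder_iff_pow_eq_one.2 ⟨n, hn, ?_⟩
    have hsn : ∀ n t, (s ^ n) (e t) = e ((φ ^ n) t) := by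
      intro n
      induction n with
      | zero => intro t; rfl
      | succ n ih =>
        intro t
        rw [pow_succ, pow_succ, LinearEquiv.mul_apply, LinearEquiv.mul_apply, hs, ih]
    ext x
    obtain ⟨t, rfl⟩ := e.surjective x
    rw [hsn, hpow]
    rfl
  · have hker : LinearMap.ker ((s : cartanC r hω f →ₗ[ℂ] cartanC r hω f) - LinearMap.id) =
        LinearMap.ker σ :=
      Submodule.map_injective_of_injective (Submodule.subtype_injective _) hfixed
    have : FiniteDimensional ℂ (cartanC r hω f) := e.finiteDimensional
    rw [hker]
    exact Module.Dual.finrank_ker_add_one_of_ne_zero hσ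

end RestrictedRoots

/-! ### Root averages as block circulants. -/

section RootAverage

variable {m r q : ℕ} [NeZero m]

theorem theta_iterate_apply_self {ω : ℂ} (hω : IsPrimitiveRoot ω m) (f : Fin q → Fin m)
    (x : sl (Idx m r q) ℂ) (n : ℕ) (p : Idx m r q) :
    (((theta r hω f)^[n] x : sl (Idx m r q) ℂ) : Matrix (Idx m r q) (Idx m r q) ℂ) p p =
      (x : Matrix (Idx m r q) (Idx m r q) ℂ) ((shift m r q ^ n) p) ((shift m r q ^ n) p) := by
  refine mul_right_cancel₀ (pow_ne_zero n (weight_ne_zero hω f p)) ?_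
  rw [theta_iterate_apply, mul_comm]

theorem epsDiff_theta_iterate {ω : ℂ} (hω : IsPrimitiveRoot ω m) (f : Fin q → Fin m)
    (k l : Fin r) (a b : Fin m) (n : ℕ) {x y : diagCartan (Idx m r q)}
    (h : (y : sl (Idx m r q) ℂ) = (theta r hω f)^[n] (x : sl (Idx m r q) ℂ)) :
    epsDiff (Sum.inl (k, a - Fin.ofNat m n)) (Sum.inl (l, b - Fin.ofNat m n)) y =
      epsDiff (Sum.inl (k, a)) (Sum.inl (l, b)) x := by
  rw [epsDiff_apply, epsDiff_apply, h, theta_iterate_apply_self, theta_iterate_apply_self,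
    shift_pow_inl, shift_pow_inl, sub_add_cancel, sub_add_cancel]

/-- The condition in `rootOrbit` constrains a form only on the image of `θ^n`; surjectivity on
diagonal matrices makes it determine the form. -/
theorem exists_diag_theta_iterate_eq {ω : ℂ} (hω : IsPrimitiveRoot ω m) (f : Fin q → Fin m)
    (n : ℕ) (y : diagCartan (Idx m r q)) :
    ∃ x : diagCartan (Idx m r q),
      (y : sl (Idx m r q) ℂ) = (theta r hω f)^[n] (x : sl (Idx m r q) ℂ) := by
  have h := (Function.RightInverse.iterate (f := theta r hω f) (g := (theta r hω f).symm)
    (fun z => (theta r hω f).apply_symm_apply z) n) (y : sl (Idx m r q) ℂ)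
  refine ⟨⟨(theta r hω f).symm^[n] y, fun u v huv => ?_⟩, h.symm⟩
  have h1 := theta_iterate_apply hω f ((theta r hω f).symm^[n] y) n
    ((shift m r q ^ n).symm u) ((shift m r q ^ n).symm v)
  have h2 : ((y : sl (Idx m r q) ℂ) : Matrix (Idx m r q) (Idx m r q) ℂ)
      ((shift m r q ^ n).symm u) ((shift m r q ^ n).symm v) = 0 :=
    y.2 ((shift m r q ^ n).symm.injective.ne huv)
  rw [h, h2, zero_mul, Equiv.apply_symm_apply, Equiv.apply_symm_apply] at h1
  exact (mul_eq_zero.1 h1.symm).resolve_left (pow_ne_zero n (weight_ne_zero hω f _))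

/-- `θ^s` moves both positions back by `s`, and the resulting roots are distinct for distinct `s`
modulo `m`. Hence the factor `|O_α| / m` is `1` for all roots between block positions. -/
theorem ncard_rootOrbit {ω : ℂ} (hω : IsPrimitiveRoot ω m) (f : Fin q → Fin m)
    {k l : Fin r} {a b : Fin m}
    (hab : (Sum.inl (k, a) : Idx m r q) ≠ Sum.inl (l, b)) :
    (rootOrbit (theta r hω f) m (diagCartan (Idx m r q))
      (epsDiff (Sum.inl (k, a)) (Sum.inl (l, b)))).ncard = m := by
  have h : rootOrbit (theta r hω f) m (diagCartan (Idx m r q))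
      (epsDiff (Sum.inl (k, a)) (Sum.inl (l, b))) =
      (fun s : Fin m => epsDiff (Sum.inl (k, a - s) : Idx m r q) (Sum.inl (l, b - s))) ''
        Set.univ := by
    ext β
    constructor
    · rintro ⟨n, hn, hβ⟩
      refine ⟨Fin.ofNat m n, Set.mem_univ _, LinearMap.ext fun y => ?_⟩
      obtain ⟨x, hx⟩ := exists_diag_theta_iterate_eq hω f n y
      exact (epsDiff_theta_iterate hω f k l a b n hx).trans (hβ x y hx).symm
    · rintro ⟨s, -, rfl⟩
      refine ⟨s, s.2, fun x y hxy => ?_⟩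
      have := epsDiff_theta_iterate hω f k l a b s hxy
      rwa [Fin.ofNat_val_eq_self] at this
  rw [h, Set.ncard_image_of_injective, Set.ncard_univ, Nat.card_eq_fintype_card, Fintype.card_fin]
  intro s s' hss
  have hne : (Sum.inl (k, a - s) : Idx m r q) ≠ Sum.inl (l, b - s) := by
    intro h
    apply hab
    simp only [Sum.inl.injEq, Prod.mk.injEq] at h ⊢
    exact ⟨h.1, sub_left_injective h.2⟩
  have := eq_of_epsDiff_eq hne hss
  simpa using this

/-- The power `P ^ d` of the cyclic permutation matrix. -/
def circ (d : Fin m) : Matrix (Fin m) (Fin m) ℂ :=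
  Matrix.of fun a b => if b = a + d then 1 else 0

theorem circ_mul_circ (d e : Fin m) : circ d * circ e = circ (d + e) := by
  ext a b
  simp only [circ, Matrix.mul_apply, Matrix.of_apply]
  rw [Finset.sum_eq_single (a + d)]
  · simp [add_assoc]
  · intro c _ hc
    simp [hc]
  · simp

theorem circ_transpose (d : Fin m) : (circ d).transpose = circ (-d) := by
  ext a b
  simp [circ, eq_add_neg_iff_add_eq, eq_comm]

/-- The matrix with `P ^ d` in the block `(k, l)` and zeros elsewhere. -/
def blockMatrix (q : ℕ) (k l : Fin r) (d : Fin m) : Matrix (Idx m r q) (Idx m r q) ℂ :=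
  Matrix.fromBlocks (Matrix.single k l 1 ⊗ₖ circ d) 0 0 0

/-- The block circulants multiply as matrix units over the group algebra of `ℤ/m`; the later
computations use only this and `blockMatrix_mul_of_ne`. -/
theorem blockMatrix_mul_same (k l n : Fin r) (d e : Fin m) :
    blockMatrix q k l d * blockMatrix q l n e = blockMatrix q k n (d + e) := by
  simp [blockMatrix, Matrix.fromBlocks_multiply, ← Matrix.mul_kronecker_mul, circ_mul_circ]

theorem blockMatrix_mul_of_ne (k n : Fin r) {l l' : Fin r} (h : l ≠ l') (d e : Fin m) :
    blockMatrix q k l d * blockMatrix q l' n e = 0 := by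
  simp [blockMatrix, Matrix.fromBlocks_multiply, ← Matrix.mul_kronecker_mul,
    Matrix.single_mul_single_of_ne _ _ _ _ h]

theorem blockMatrix_transpose (k l : Fin r) (d : Fin m) :
    (blockMatrix q k l d).transpose = blockMatrix q l k (-d) := by
  simp [blockMatrix, Matrix.fromBlocks_transpose, ← Matrix.kroneckerMap_transpose, circ_transpose]

theorem blockMatrix_inl_inl (k l k' l' : Fin r) (d a b : Fin m) :
    blockMatrix q k l d (Sum.inl (k', a)) (Sum.inl (l', b)) =
      if k = k' ∧ l = l' ∧ b = a + d then 1 else 0 := by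
  simp only [blockMatrix, Matrix.fromBlocks_apply₁₁, Matrix.kroneckerMap_apply,
    Matrix.single_apply, circ, Matrix.of_apply, ite_mul, one_mul, zero_mul, ← ite_and, and_assoc]

@[simp] theorem blockMatrix_inr_left (k l : Fin r) (d : Fin m) (b : Fin q) (p : Idx m r q) :
    blockMatrix q k l d (Sum.inr b) p = 0 := by
  rcases p with p | b' <;> rfl

@[simp] theorem blockMatrix_inr_right (k l : Fin r) (d : Fin m) (b : Fin q) (p : Idx m r q) :
    blockMatrix q k l d p (Sum.inr b) = 0 := by
  rcases p with p | b' <;> rfl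

/-- The `θ`-translates of a matrix unit keep the column-minus-row difference `j - i` and meet each
position of that cyclic diagonal once. -/
theorem coe_e0 {ω : ℂ} (hω : IsPrimitiveRoot ω m) (f : Fin q → Fin m)
    {k l : Fin r} {i j : Fin m}
    (hij : (Sum.inl (k, i) : Idx m r q) ≠ Sum.inl (l, j)) :
    (e0 hω f hij : Matrix (Idx m r q) (Idx m r q) ℂ) = blockMatrix q k l (j - i) := by
  have hm0 : (m : ℂ) ≠ 0 := Nat.cast_ne_zero.2 (NeZero.ne m)
  rw [e0, rootAverage, ncard_rootOrbit hω f hij, div_self hm0, one_smul,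
    AddSubmonoidClass.coe_finsetSum]
  simp only [mul_zero, pow_zero, inv_one, one_smul]
  have hE : ∀ (n : ℕ) (p p' : Idx m r q),
      (((theta r hω f)^[n] (single (Sum.inl (k, i)) (Sum.inl (l, j)) hij 1) :
        sl (Idx m r q) ℂ) : Matrix (Idx m r q) (Idx m r q) ℂ) p p' * weight r ω f p' ^ n =
      weight r ω f p ^ n * Matrix.single (Sum.inl (k, i)) (Sum.inl (l, j)) (1 : ℂ)
        ((shift m r q ^ n) p) ((shift m r q ^ n) p') :=
    fun n p p' => theta_iterate_apply hω f _ n p p'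
  ext p p'
  rw [Matrix.sum_apply]
  rcases p with ⟨k', a⟩ | b
  · rcases p' with ⟨l', a'⟩ | b'
    · rw [blockMatrix_inl_inl, Finset.sum_range]
      have hE' : ∀ s : Fin m, (((theta r hω f)^[s] (single (Sum.inl (k, i)) (Sum.inl (l, j)) hij 1) :
          sl (Idx m r q) ℂ) : Matrix (Idx m r q) (Idx m r q) ℂ)
            (Sum.inl (k', a)) (Sum.inl (l', a')) =
          if (k = k' ∧ i = a + s) ∧ l = l' ∧ j = a' + s then 1 else 0 := by
        intro s
        have h := hE s (Sum.inl (k', a)) (Sum.inl (l', a'))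
        rw [weight_inl, weight_inl, one_pow, mul_one, one_mul, shift_pow_inl, shift_pow_inl,
          Matrix.single_apply, Fin.ofNat_val_eq_self] at h
        simpa only [Sum.inl.injEq, Prod.mk.injEq] using h
      refine (Finset.sum_congr rfl fun s _ => hE' s).trans ?_
      -- Only the power of `θ` that carries row `i` to row `a` contributes.
      rw [Finset.sum_eq_single (i - a)]
      · refine if_congr ?_ rfl rfl
        rw [add_sub_cancel]
        constructor
        · rintro ⟨⟨h1, -⟩, h2, h3⟩
          exact ⟨h1, h2, by rw [h3]; abel⟩
        · rintro ⟨h1, h2, h3⟩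
          exact ⟨⟨h1, rfl⟩, h2, by rw [h3]; abel⟩
      · intro s _ hs
        exact if_neg fun h => hs (by rw [h.1.2]; abel)
      · simp
    · rw [blockMatrix_inr_right]
      refine Finset.sum_eq_zero fun n _ => ?_
      refine mul_right_cancel₀ (pow_ne_zero n (weight_ne_zero (r := r) hω f (Sum.inr b'))) ?_
      rw [hE, shift_pow_inr, Matrix.single_apply, if_neg (by simp), mul_zero, zero_mul]
  · rw [blockMatrix_inr_left]
    refine Finset.sum_eq_zero fun n _ => ?_
    refine mul_right_cancel₀ (pow_ne_zero n (weight_ne_zero hω f p')) ?_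
    rw [hE, shift_pow_inr, Matrix.single_apply, if_neg (by simp), mul_zero, zero_mul]

theorem mem_gradedPiece_zero_of_blockMatrix {ω : ℂ} (hω : IsPrimitiveRoot ω m)
    (f : Fin q → Fin m) {x : sl (Idx m r q) ℂ} {k l : Fin r} {d : Fin m}
    (hx : (x : Matrix (Idx m r q) (Idx m r q) ℂ) = blockMatrix q k l d) :
    x ∈ gradedPiece (theta r hω f) ω 0 := by
  rw [mem_gradedPiece_theta, hx]
  rintro (⟨k', a⟩ | b) (⟨l', a'⟩ | b')
  · simp only [shift_inl, blockMatrix_inl_inl, weight_inl, pow_zero, one_mul, mul_one]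
    refine if_congr (and_congr_right fun _ => and_congr_right fun _ => ?_) rfl rfl
    rw [add_right_comm, add_left_inj]
  all_goals simp

theorem e0_mem_gradedPiece_zero {ω : ℂ} (hω : IsPrimitiveRoot ω m) (f : Fin q → Fin m)
    {k l : Fin r} {i j : Fin m}
    (hij : (Sum.inl (k, i) : Idx m r q) ≠ Sum.inl (l, j)) :
    e0 hω f hij ∈ gradedPiece (theta r hω f) ω 0 :=
  mem_gradedPiece_zero_of_blockMatrix hω f (coe_e0 hω f hij)

end RootAverage

/-! ### The two families of reflections. -/

section Reflections

variable {m r q : ℕ} [NeZero m]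

/-- A nonzero entry joins position `a` of block `k` to `a + d` of block `l`, so the identity reduces
to `t'_k ω^a = t_l ω^(a+d)`. -/
theorem diagonal_mul_blockMatrix {ω : ℂ} (hω : IsPrimitiveRoot ω m) {k l : Fin r} {d : Fin m}
    {t t' : Fin r → ℂ} (h : t' k = t l * ω ^ (d : ℕ)) :
    Matrix.diagonal (cartanEntry ω t') * blockMatrix q k l d =
      blockMatrix q k l d * Matrix.diagonal (cartanEntry ω t) := by
  ext p p'
  rw [Matrix.diagonal_mul, Matrix.mul_diagonal]
  rcases p with ⟨k', a⟩ | b <;> rcases p' with ⟨l', a'⟩ | b'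
  · rw [blockMatrix_inl_inl]
    split_ifs with hk
    · obtain ⟨rfl, rfl, rfl⟩ := hk
      rw [cartanEntry_inl, cartanEntry_inl, pow_val_add hω, h]
      ring
    · simp
  all_goals simp

theorem blockMatrix_self_zero (k : Fin r) :
    blockMatrix q k k (0 : Fin m) =
      Matrix.diagonal (Sum.elim (fun p => if p.1 = k then 1 else 0) fun _ => 0) := by
  ext p p'
  rcases p with ⟨k', a⟩ | b <;> rcases p' with ⟨l', a'⟩ | b'
  · rw [blockMatrix_inl_inl, Matrix.diagonal_apply, add_zero]
    by_cases h1 : k' = k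
    · subst h1
      by_cases h2 : a = a' <;> by_cases h3 : k' = l' <;> simp [h2, h3, eq_comm (a := a')]
    · simp [h1, Ne.symm h1]
  · simp
  · simp
  · simp [Matrix.diagonal_apply]

theorem one_sub_blockMatrix_mul_diagonal {ω : ℂ} (k : Fin r) {t t' : Fin r → ℂ}
    (h : ∀ a, a ≠ k → t' a = t a) :
    (1 - blockMatrix q k k (0 : Fin m)) * Matrix.diagonal (cartanEntry ω t) =
      Matrix.diagonal (cartanEntry ω t') * (1 - blockMatrix q k k 0) := by
  rw [blockMatrix_self_zero, ← Matrix.diagonal_one, Matrix.diagonal_sub,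
    Matrix.diagonal_mul_diagonal, Matrix.diagonal_mul_diagonal]
  congr 1
  funext p
  rcases p with ⟨k', a⟩ | b
  · by_cases hk : k' = k
    · simp [hk]
    · simp [hk, h k' hk]
  · simp

theorem one_sub_sub_blockMatrix_mul_diagonal {ω : ℂ} {k l : Fin r} (hkl : k ≠ l)
    {t t' : Fin r → ℂ} (h : ∀ a, a ≠ k → a ≠ l → t' a = t a) :
    (1 - blockMatrix q k k (0 : Fin m) - blockMatrix q l l 0) *
        Matrix.diagonal (cartanEntry ω t) =
      Matrix.diagonal (cartanEntry ω t') *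
        (1 - blockMatrix q k k 0 - blockMatrix q l l 0) := by
  rw [blockMatrix_self_zero, blockMatrix_self_zero, ← Matrix.diagonal_one, Matrix.diagonal_sub,
    Matrix.diagonal_sub, Matrix.diagonal_mul_diagonal, Matrix.diagonal_mul_diagonal]
  congr 1
  funext p
  rcases p with ⟨k', a⟩ | b
  · by_cases hk : k' = k
    · simp [hk, hkl]
    · by_cases hl : k' = l
      · simp [hl, hkl.symm]
      · simp [hk, hl, h k' hk hl]
  · simp

/-- Multiplication of the coordinate `l` by `ω`. -/
def scaleCoord (l : Fin r) {ω : ℂ} (h : ω ≠ 0) : (Fin r → ℂ) ≃ₗ[ℂ] (Fin r → ℂ) :=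
  LinearEquiv.piCongrRight fun a =>
    LinearEquiv.smulOfNeZero ℂ ℂ (if a = l then ω else 1) (by split_ifs <;> simp [h])

theorem scaleCoord_apply (l : Fin r) {ω : ℂ} (h : ω ≠ 0) (t : Fin r → ℂ) (a : Fin r) :
    scaleCoord l h t a = (if a = l then ω else 1) * t a := rfl

theorem isOfFinOrder_scaleCoord (l : Fin r) {ω : ℂ} (hω : IsPrimitiveRoot ω m) :
    IsOfFinOrder (scaleCoord l (hω.ne_zero (NeZero.ne m))) := by
  refine isOfFinOrder_iff_pow_eq_one.2 ⟨m, NeZero.pos m, ?_⟩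
  have h : ∀ (n : ℕ) (t : Fin r → ℂ) (a : Fin r),
      ((scaleCoord l (hω.ne_zero (NeZero.ne m))) ^ n) t a = (if a = l then ω else 1) ^ n * t a := by
    intro n
    induction n with
    | zero => intro t a; simp
    | succ n ih =>
      intro t a
      rw [pow_succ, LinearEquiv.mul_apply, ih, scaleCoord_apply]
      ring
  refine LinearEquiv.ext fun t => funext fun a => ?_
  rw [h]
  split_ifs
  · rw [hω.pow_eq_one, one_mul]; rfl
  · rw [one_pow, one_mul]; rfl

/-- The swap of the coordinates `k` and `l`, combined with multiplication by `c` and `c'`. -/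
def swapCoord {k l : Fin r} (hkl : k ≠ l) {c c' : ℂ} (h : c * c' = 1) :
    (Fin r → ℂ) ≃ₗ[ℂ] (Fin r → ℂ) :=
  LinearEquiv.ofInvolutive
    { toFun := fun t a => if a = k then t l * c else if a = l then t k * c' else t a
      map_add' := fun t t' => by
        funext a
        simp only [Pi.add_apply]
        split_ifs <;> ring
      map_smul' := fun z t => by
        funext a
        simp only [Pi.smul_apply, smul_eq_mul, RingHom.id_apply]
        split_ifs <;> ring }
    (fun t => by
      funext a
      simp only [LinearMap.coe_mk, AddHom.coe_mk, hkl.symm, if_true, if_false]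
      split_ifs with h1 h2
      · rw [h1]; linear_combination t k * h
      · rw [h2]; linear_combination t l * h
      · rfl)

theorem swapCoord_apply {k l : Fin r} (hkl : k ≠ l) {c c' : ℂ} (h : c * c' = 1)
    (t : Fin r → ℂ) (a : Fin r) :
    swapCoord hkl h t a = if a = k then t l * c else if a = l then t k * c' else t a := rfl

theorem isOfFinOrder_swapCoord {k l : Fin r} (hkl : k ≠ l) {c c' : ℂ} (h : c * c' = 1) :
    IsOfFinOrder (swapCoord hkl h) := by
  refine isOfFinOrder_iff_pow_eq_one.2 ⟨2, two_pos, LinearEquiv.ext fun t => ?_⟩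
  rw [pow_two, LinearEquiv.mul_apply]
  exact (swapCoord hkl h).left_inv t

theorem pow_val_mul_pow_val_neg {ω : ℂ} (hω : IsPrimitiveRoot ω m) (d : Fin m) :
    ω ^ (d : ℕ) * ω ^ ((-d : Fin m) : ℕ) = 1 := by
  rw [← pow_val_add hω, add_neg_cancel, Fin.val_zero, pow_zero]

theorem expLiftsReflection_rotation {ω : ℂ} (hω : IsPrimitiveRoot ω m) (hm : 1 < m)
    (f : Fin q → Fin m) {σ : Module.Dual ℂ (cartanC r hω f)} (hσ : σ ≠ 0)
    {k l : Fin r} (hkl : k ≠ l) (i j : Fin m)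
    (hij : (Sum.inl (k, i) : Idx m r q) ≠ Sum.inl (l, j))
    (h : hyperplane σ = hyperplaneTwo hω hm q k l i j) :
    ExpLiftsReflection (theta r hω f) ω σ (rotation hω f hij) := by
  obtain ⟨J, hJ⟩ : ∃ J, J = blockMatrix q k l (j - i) - blockMatrix q l k (-(j - i)) := ⟨_, rfl⟩
  have hX : (rotation hω f hij : Matrix (Idx m r q) (Idx m r q) ℂ) = ((Real.pi : ℂ) / 2) • J := by
    rw [rotation, SetLike.val_smul, AddSubgroupClass.coe_sub, coe_e0, coe_e0, hJ, neg_sub]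
  have hJJ : J * J = -(blockMatrix q k k 0 + blockMatrix q l l 0) := by
    rw [hJ, Matrix.sub_mul, Matrix.mul_sub, Matrix.mul_sub, blockMatrix_mul_same,
      blockMatrix_mul_same, blockMatrix_mul_of_ne _ _ hkl.symm, blockMatrix_mul_of_ne _ _ hkl,
      add_neg_cancel, neg_add_cancel]
    abel
  have hJJJ : J * J * J = -J := by
    rw [hJJ, Matrix.neg_mul, hJ, Matrix.add_mul, Matrix.mul_sub, Matrix.mul_sub,
      blockMatrix_mul_same, blockMatrix_mul_same, blockMatrix_mul_of_ne _ _ hkl.symm,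
      blockMatrix_mul_of_ne _ _ hkl, zero_add, zero_add]
    abel
  have hexp : NormedSpace.exp (rotation hω f hij : Matrix (Idx m r q) (Idx m r q) ℂ) =
      (1 - blockMatrix q k k 0 - blockMatrix q l l 0) +
        (blockMatrix q k l (j - i) - blockMatrix q l k (-(j - i))) := by
    rw [hX, exp_pi_div_two_smul hJJJ, hJJ, hJ]
    abel
  have hT : (rotation hω f hij : Matrix (Idx m r q) (Idx m r q) ℂ).transpose =
      -(rotation hω f hij : Matrix (Idx m r q) (Idx m r q) ℂ) := by
    rw [hX, Matrix.transpose_smul, hJ, Matrix.transpose_sub, blockMatrix_transpose,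
      blockMatrix_transpose, neg_neg, ← smul_neg,
      neg_sub (blockMatrix q k l (j - i))]
  -- The factors of the swap are the two inverse powers of `ω` picked up in crossing between the
  -- blocks in the two directions.
  have hc := pow_val_mul_pow_val_neg hω (j - i)
  refine expLiftsReflection_of_conj hω hm f hσ
    (Submodule.smul_mem _ _ (sub_mem (e0_mem_gradedPiece_zero hω f hij)
      (e0_mem_gradedPiece_zero hω f hij.symm)))
    (det_exp_eq_one_of_transpose_eq_neg hT) (swapCoord hkl hc) (isOfFinOrder_swapCoord hkl hc)
    (fun t => ?_) (fun t => ?_)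
  · rw [hexp, Matrix.add_mul, Matrix.mul_add, Matrix.mul_sub _ (blockMatrix q k l (j - i)),
      Matrix.sub_mul (blockMatrix q k l (j - i)),
      diagonal_mul_blockMatrix hω (t := t), diagonal_mul_blockMatrix hω (t := t),
      one_sub_sub_blockMatrix_mul_diagonal hkl (t' := swapCoord hkl hc t)]
    · intro a h1 h2
      rw [swapCoord_apply, if_neg h1, if_neg h2]
    · rw [swapCoord_apply, if_neg hkl.symm, if_pos rfl]
    · rw [swapCoord_apply, if_pos rfl]
  · have h0 : ω ^ (i : ℕ) ≠ 0 := pow_ne_zero _ (hω.ne_zero (NeZero.ne m))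
    have hji : ω ^ ((j - i : Fin m) : ℕ) * ω ^ (i : ℕ) = ω ^ (j : ℕ) := by
      rw [← pow_val_add hω, sub_add_cancel]
    rw [h, cartanVec_mem_hyperplaneTwo hω hm hkl]
    constructor
    · intro ht
      have h1 := congrFun ht k
      rw [swapCoord_apply, if_pos rfl] at h1
      rw [← h1, mul_assoc, hji]
    · intro ht
      have h1 : t l * ω ^ ((j - i : Fin m) : ℕ) = t k :=
        mul_right_cancel₀ h0 (by rw [mul_assoc, hji, ht])
      funext a
      rw [swapCoord_apply]
      split_ifs with ha hb
      · rw [h1, ha]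
      · rw [hb, ← h1, mul_assoc, hc, mul_one]
      · rfl

/-! ### The discrete Fourier transform -/

/-- Orthogonality of characters of `ℤ/m`: for `a ≠ b` this is a full geometric sum with ratio an
`m`-th root of unity other than `1`. -/
theorem sum_pow_mul_inv_pow {ω : ℂ} (hω : IsPrimitiveRoot ω m) (a b : Fin m) :
    ∑ j : Fin m, ω ^ ((j : ℕ) * (a : ℕ)) * (ω ^ ((j : ℕ) * (b : ℕ)))⁻¹ =
      if a = b then (m : ℂ) else 0 := by
  have h0 : ω ≠ 0 := hω.ne_zero (NeZero.ne m)
  obtain ⟨ζ, hζ⟩ : ∃ ζ, ζ = ω ^ (a : ℕ) * (ω ^ (b : ℕ))⁻¹ := ⟨_, rfl⟩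
  have h1 : ∀ j : Fin m, ω ^ ((j : ℕ) * (a : ℕ)) * (ω ^ ((j : ℕ) * (b : ℕ)))⁻¹ = ζ ^ (j : ℕ) := by
    intro j
    rw [hζ, mul_pow, inv_pow, ← pow_mul, ← pow_mul, mul_comm (j : ℕ), mul_comm (j : ℕ)]
  rw [Finset.sum_congr rfl fun j _ => h1 j, Fin.sum_univ_eq_sum_range (fun j => ζ ^ j) m]
  split_ifs with hab
  · rw [hab, mul_inv_cancel₀ (pow_ne_zero _ h0)] at hζ
    simp [hζ]
  · have hζ1 : ζ ≠ 1 := fun h => hab (pow_val_injective hω (by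
      rw [hζ] at h
      exact eq_of_div_eq_one (by rwa [div_eq_mul_inv])))
    have hζm : ζ ^ m = 1 := by
      rw [hζ, mul_pow, inv_pow, ← pow_mul, ← pow_mul, mul_comm (a : ℕ), mul_comm (b : ℕ), pow_mul,
        pow_mul, hω.pow_eq_one, one_pow, one_pow, inv_one, one_mul]
    rw [geom_sum_eq hζ1, hζm, sub_self, zero_div]

theorem pow_mul_val_add {ω : ℂ} (hω : IsPrimitiveRoot ω m) (j a b : Fin m) :
    ω ^ ((j : ℕ) * ((a + b : Fin m) : ℕ)) =
      ω ^ ((j : ℕ) * (a : ℕ)) * ω ^ ((j : ℕ) * (b : ℕ)) := by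
  rw [mul_comm, pow_mul, pow_val_add hω, mul_pow, ← pow_mul, ← pow_mul, mul_comm (a : ℕ),
    mul_comm (b : ℕ)]

theorem vandermondeA_apply (ω : ℂ) (j k : Fin m) :
    vandermondeA m ω j k = ω ^ ((j : ℕ) * (k : ℕ)) := by
  rw [vandermondeA, Matrix.vandermonde_apply, pow_mul]

theorem vandermondeA_map_star_apply {ω : ℂ} (hω : IsPrimitiveRoot ω m) (j k : Fin m) :
    (vandermondeA m ω).map star j k = (ω ^ ((j : ℕ) * (k : ℕ)))⁻¹ := by
  rw [Matrix.map_apply, vandermondeA_apply, star_pow, ← inv_pow]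
  congr 1
  exact (Complex.inv_eq_conj (hω.norm'_eq_one (NeZero.ne m))).symm

theorem vandermondeA_mul_map_star {ω : ℂ} (hω : IsPrimitiveRoot ω m) :
    vandermondeA m ω * ((1 / (m : ℂ)) • (vandermondeA m ω).map star) = 1 := by
  have hm0 : (m : ℂ) ≠ 0 := Nat.cast_ne_zero.2 (NeZero.ne m)
  ext j k
  rw [Matrix.mul_smul, Matrix.smul_apply, Matrix.mul_apply]
  have : ∑ i, vandermondeA m ω j i * (vandermondeA m ω).map star i k =
      if j = k then (m : ℂ) else 0 := by
    rw [← sum_pow_mul_inv_pow hω]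
    refine Finset.sum_congr rfl fun i _ => ?_
    rw [vandermondeA_apply, vandermondeA_map_star_apply hω, mul_comm (j : ℕ)]
  rw [this, Matrix.one_apply]
  split_ifs <;> simp [hm0]

theorem vandermondeA_mulVec_eq_iff {ω : ℂ} (hω : IsPrimitiveRoot ω m) (L b : Fin m → ℂ) :
    (vandermondeA m ω).mulVec b = L ↔
      b = (1 / (m : ℂ)) • ((vandermondeA m ω).map star).mulVec L := by
  have h := vandermondeA_mul_map_star hω
  rw [← Matrix.smul_mulVec]
  constructor
  · rintro rfl
    rw [Matrix.mulVec_mulVec, mul_eq_one_comm.1 h, Matrix.one_mulVec]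
  · rintro rfl
    rw [Matrix.mulVec_mulVec, h, Matrix.one_mulVec]

/-- The exponent is `m (m - 1) / 2`. For odd `m` it is divisible by `m`; for even `m` use `ω^(m/2) =
-1`. -/
theorem prod_pow_val {ω : ℂ} (hω : IsPrimitiveRoot ω m) :
    ∏ j : Fin m, ω ^ (j : ℕ) = (-1) ^ (m + 1) := by
  rw [Fin.prod_univ_eq_prod_range (fun j => ω ^ j) m, Finset.prod_pow_eq_pow_sum]
  have hs := Finset.sum_range_id_mul_two m
  rcases Nat.even_or_odd' m with ⟨n, hn | hn⟩
  · have hn0 : 0 < n := by have := NeZero.pos m; omega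
    have hs' : ∑ i ∈ Finset.range m, i = n * (m - 1) := by
      apply Nat.eq_of_mul_eq_mul_right two_pos
      rw [hs]
      nth_rewrite 1 [hn]
      ring
    have h2 : IsPrimitiveRoot (ω ^ n) 2 := hω.pow (NeZero.pos m) (by rw [hn, mul_comm])
    rw [hs', pow_mul, h2.eq_neg_one_of_two_right, hn, Odd.neg_one_pow ⟨n - 1, by omega⟩,
      Odd.neg_one_pow ⟨n, rfl⟩]
  · have hs' : ∑ i ∈ Finset.range m, i = m * n := by
      apply Nat.eq_of_mul_eq_mul_right two_pos
      rw [hs, show m - 1 = n * 2 by omega, mul_assoc]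
    rw [hs', pow_mul, hω.pow_eq_one, one_pow, Even.neg_one_pow ⟨n + 1, by omega⟩]

theorem exists_pow_eq_neg_one_pow (m : ℕ) [NeZero m] : ∃ ε : ℂ, ε ^ m = (-1) ^ (m + 1) :=
  IsAlgClosed.exists_pow_nat_eq _ (NeZero.pos m)

theorem exists_isLogVector_sum_eq_zero {ω ε : ℂ} (hω : IsPrimitiveRoot ω m)
    (hε : ε ^ m = (-1) ^ (m + 1)) : ∃ L : Fin m → ℂ, IsLogVector m ω ε L ∧ ∑ j, L j = 0 := by
  have h0 : ω ≠ 0 := hω.ne_zero (NeZero.ne m)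
  have hε0 : ε ≠ 0 := by
    rintro rfl
    rw [zero_pow (NeZero.ne m)] at hε
    exact pow_ne_zero (m + 1) (neg_ne_zero.2 one_ne_zero) hε.symm
  obtain ⟨L, hL⟩ : ∃ L : Fin m → ℂ, IsLogVector m ω ε L :=
    ⟨fun j => Complex.log (ε * ω ^ (j : ℕ)), fun j =>
      Complex.exp_log (mul_ne_zero hε0 (pow_ne_zero _ h0))⟩
  have hsum : Complex.exp (∑ j, L j) = 1 := by
    rw [Complex.exp_sum, Finset.prod_congr rfl fun j _ => hL j, Finset.prod_mul_distrib,
      prod_pow_val hω]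
    simp [hε, ← mul_pow]
  obtain ⟨n, hn⟩ := Complex.exp_eq_one_iff.1 hsum
  -- The product of all `ε ω^j` is `1`, so any branches sum to a multiple of `2πi`; the whole excess
  -- is absorbed by the branch at `j = 0`.
  refine ⟨fun j => L j - if j = 0 then (n : ℂ) * (2 * Real.pi * Complex.I) else 0,
    fun j => ?_, by simp [hn]⟩
  dsimp only
  split_ifs
  · rw [Complex.exp_sub, hL, Complex.exp_int_mul_two_pi_mul_I, div_one]
  · rw [sub_zero, hL]

/-- The eigenvectors of the cyclic permutation matrix in the block `l`. -/
def fourierVec (ω : ℂ) (l : Fin r) (j : Fin m) : Idx m r q → ℂ :=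
  Sum.elim (fun p => if p.1 = l then ω ^ ((j : ℕ) * (p.2 : ℕ)) else 0) fun _ => 0

/-- The dual vectors of the eigenvectors of the cyclic permutation matrix in the block `l`. -/
def fourierCovec (ω : ℂ) (l : Fin r) (j : Fin m) : Idx m r q → ℂ :=
  Sum.elim (fun p => if p.1 = l then (m : ℂ)⁻¹ * (ω ^ ((j : ℕ) * (p.2 : ℕ)))⁻¹ else 0) fun _ => 0

theorem fourierCovec_dotProduct_fourierVec {ω : ℂ} (hω : IsPrimitiveRoot ω m) (l : Fin r)
    (i j : Fin m) :
    fourierCovec (q := q) ω l i ⬝ᵥ fourierVec ω l j = if i = j then 1 else 0 := by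
  have hm0 : (m : ℂ) ≠ 0 := Nat.cast_ne_zero.2 (NeZero.ne m)
  simp only [dotProduct, Fintype.sum_sum_type, Fintype.sum_prod_type, fourierVec, fourierCovec,
    Sum.elim_inl, Sum.elim_inr, mul_zero, Finset.sum_const_zero, add_zero]
  rw [Finset.sum_eq_single l]
  · simp only [if_true]
    have : ∑ a : Fin m, (m : ℂ)⁻¹ * (ω ^ ((i : ℕ) * (a : ℕ)))⁻¹ * ω ^ ((j : ℕ) * (a : ℕ)) =
        (m : ℂ)⁻¹ * if j = i then (m : ℂ) else 0 := by
      rw [← sum_pow_mul_inv_pow hω, Finset.mul_sum]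
      refine Finset.sum_congr rfl fun a _ => ?_
      rw [mul_comm (i : ℕ), mul_comm (j : ℕ)]
      ring
    rw [this]
    by_cases h : i = j
    · simp [h, hm0]
    · simp [h, Ne.symm h]
  · intro l' _ h
    simp [h]
  · simp

/-- The spectral decomposition of `P^d` on block `l`: the `j`-th Fourier vector has eigenvalue
`ω^(jd)`. -/
theorem blockMatrix_eq_sum {ω : ℂ} (hω : IsPrimitiveRoot ω m) (l : Fin r) (d : Fin m) :
    blockMatrix q l l d = ∑ j : Fin m, ω ^ ((j : ℕ) * (d : ℕ)) •
      Matrix.vecMulVec (fourierVec ω l j) (fourierCovec ω l j) := by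
  have hm0 : (m : ℂ) ≠ 0 := Nat.cast_ne_zero.2 (NeZero.ne m)
  ext p p'
  rw [Matrix.sum_apply]
  simp only [Matrix.smul_apply, Matrix.vecMulVec_apply, smul_eq_mul]
  rcases p with ⟨k, a⟩ | b <;> rcases p' with ⟨k', a'⟩ | b'
  · rw [blockMatrix_inl_inl]
    simp only [fourierVec, fourierCovec, Sum.elim_inl]
    by_cases hk : k = l <;> by_cases hk' : k' = l
    · subst hk
      subst hk'
      simp only [if_true, true_and]
      have : ∑ j : Fin m, ω ^ ((j : ℕ) * (d : ℕ)) *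
          (ω ^ ((j : ℕ) * (a : ℕ)) * ((m : ℂ)⁻¹ * (ω ^ ((j : ℕ) * (a' : ℕ)))⁻¹)) =
          (m : ℂ)⁻¹ * if a + d = a' then (m : ℂ) else 0 := by
        rw [← sum_pow_mul_inv_pow hω, Finset.mul_sum]
        refine Finset.sum_congr rfl fun j _ => ?_
        rw [pow_mul_val_add hω]
        ring
      rw [this]
      by_cases h : a' = a + d
      · simp [h, hm0]
      · simp [h, Ne.symm h]
    · simp [hk', Ne.symm hk']
    · simp [hk, Ne.symm hk]
    · simp [hk, Ne.symm hk]
  all_goals simp [fourierVec, fourierCovec]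

theorem coe_rowSum {ω : ℂ} (hω : IsPrimitiveRoot ω m) (f : Fin q → Fin m) (l : Fin r)
    (a : Fin m → ℂ) : (rowSum hω f l a : Matrix (Idx m r q) (Idx m r q) ℂ) =
      ∑ j, ((vandermondeA m ω).mulVec a j - a 0) •
        Matrix.vecMulVec (fourierVec ω l j) (fourierCovec ω l j) := by
  -- Restoring the missing term `k = 0` completes the Vandermonde sum; it is the source of the shift
  -- by `a 0` in every eigenvalue.
  have h1 : (rowSum hω f l a : Matrix (Idx m r q) (Idx m r q) ℂ) + a 0 • blockMatrix q l l 0 =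
      ∑ k, a k • blockMatrix q l l k := by
    rw [rowSum, AddSubmonoidClass.coe_finsetSum]
    have h2 : ∀ k : {k : Fin m // k ≠ 0},
        ((a k • e0Row hω f l k k.2 : sl (Idx m r q) ℂ) : Matrix (Idx m r q) (Idx m r q) ℂ) =
          a k • blockMatrix q l l (k : Fin m) := by
      intro k
      rw [SetLike.val_smul, e0Row, coe_e0, sub_zero]
    rw [Finset.sum_congr rfl fun k _ => h2 k, ← Finset.sum_erase_add _ _ (Finset.mem_univ (0 : Fin m))]
    congr 1
    exact (Finset.sum_subtype _ (by simp) fun k => a k • blockMatrix q l l k).symm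
  have h3 : ∑ k, a k • blockMatrix q l l k = ∑ j, (vandermondeA m ω).mulVec a j •
      Matrix.vecMulVec (fourierVec ω l j) (fourierCovec ω l j) := by
    simp only [blockMatrix_eq_sum hω, Finset.smul_sum, smul_smul]
    rw [Finset.sum_comm]
    refine Finset.sum_congr rfl fun j _ => ?_
    rw [← Finset.sum_smul]
    congr 1
    refine Finset.sum_congr rfl fun k _ => ?_
    dsimp only
    rw [mul_comm]
    congr 1
    exact (vandermondeA_apply ω j k).symm
  rw [eq_sub_of_add_eq h1, h3, blockMatrix_eq_sum hω l 0, Finset.smul_sum,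
    ← Finset.sum_sub_distrib]
  refine Finset.sum_congr rfl fun j _ => ?_
  rw [Fin.val_zero, mul_zero, pow_zero, one_smul, sub_smul]

/-- On block `l` the exponential has eigenvalues `exp (L_j - a_0) = ε exp (-a_0) ω^j`, so it is a
scalar times `P`. The scalar disappears under conjugation, so `a_0` need not vanish, and determinant
`1` follows from trace zero. -/
theorem expLiftsReflection_rowSum {ω : ℂ} (hω : IsPrimitiveRoot ω m) (hm : 1 < m)
    (f : Fin q → Fin m) {σ : Module.Dual ℂ (cartanC r hω f)} (hσ : σ ≠ 0)
    (l : Fin r) (h : hyperplane σ = hyperplaneOne hω hm q l) {ε : ℂ} {L a : Fin m → ℂ}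
    (hL : IsLogVector m ω ε L) (ha : (vandermondeA m ω).mulVec a = L) :
    ExpLiftsReflection (theta r hω f) ω σ (rowSum hω f l a) := by
  have hX := coe_rowSum hω f l a
  rw [ha] at hX
  have hdual := fourierCovec_dotProduct_fourierVec (q := q) hω l
  have hexp : NormedSpace.exp (rowSum hω f l a : Matrix (Idx m r q) (Idx m r q) ℂ) =
      1 - blockMatrix q l l 0 + (ε * Complex.exp (-a 0)) • blockMatrix q l l 1 := by
    rw [hX, matrix_exp_sum_smul_of_orthogonal_idempotents _ _
      (vecMulVec_mul_vecMulVec_of_dual hdual), sub_add, blockMatrix_eq_sum hω l 0,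
      blockMatrix_eq_sum hω l 1, Finset.smul_sum, ← Finset.sum_sub_distrib, sub_eq_add_neg,
      ← Finset.sum_neg_distrib]
    congr 1
    refine Finset.sum_congr rfl fun j _ => ?_
    rw [mul_comm (j : ℕ) ((1 : Fin m) : ℕ), pow_mul _ ((1 : Fin m) : ℕ), pow_val_one hω,
      Fin.val_zero, mul_zero, pow_zero, sub_eq_add_neg (L j), Complex.exp_add, hL j]
    module
  have htr : (rowSum hω f l a : Matrix (Idx m r q) (Idx m r q) ℂ).trace = 0 := (rowSum hω f l a).2
  have hdet : (NormedSpace.exp (rowSum hω f l a : Matrix (Idx m r q) (Idx m r q) ℂ)).det = 1 := by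
    rw [hX, det_exp_sum_smul_vecMulVec hdual, ← hX, htr, Complex.exp_zero]
  have h0 : ω ≠ 0 := hω.ne_zero (NeZero.ne m)
  refine expLiftsReflection_of_conj hω hm f hσ
    (Submodule.sum_mem _ fun k _ => Submodule.smul_mem _ _ (e0_mem_gradedPiece_zero hω f _)) hdet
    (scaleCoord l h0) (isOfFinOrder_scaleCoord l hω) (fun t => ?_) (fun t => ?_)
  · rw [hexp, Matrix.add_mul, Matrix.mul_add, Matrix.mul_smul, Matrix.smul_mul,
      diagonal_mul_blockMatrix hω (t := t),
      one_sub_blockMatrix_mul_diagonal l (t' := scaleCoord l h0 t)]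
    · intro b hb
      rw [scaleCoord_apply, if_neg hb, one_mul]
    · rw [scaleCoord_apply, if_pos rfl, pow_val_one hω, mul_comm]
  · rw [h, cartanVec_mem_hyperplaneOne]
    constructor
    · intro ht
      have h1 := congrFun ht l
      rw [scaleCoord_apply, if_pos rfl] at h1
      have h2 : (ω - 1) * t l = 0 := by linear_combination h1
      exact (mul_eq_zero.1 h2).resolve_left (sub_ne_zero.2 (hω.ne_one hm))
    · intro ht
      funext b
      rw [scaleCoord_apply]
      split_ifs with hb
      · rw [hb, ht, mul_zero]
      · rw [one_mul]

end Reflections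

end ThetaGroup

end

/-! ### Assembly of the theorem. -/

open ThetaGroup in
theorem mainTheorem3 (m r q : ℕ) [NeZero m] (hm : 1 < m) (hr : 1 ≤ r)
    (ω : ℂ) (hω : IsPrimitiveRoot ω m)
    (f : Fin q → Fin m) (hf : ¬ Function.Surjective f) :
    -- the degree one part `c` of the standard Cartan subalgebra is a Cartan subspace, with
    -- basis `s_1, …, s_r`
    (IsCartanSubspace (theta r hω f) ω (cartanC r hω f) ∧
      LinearIndependent ℂ (sVec hω hm q : Fin r → _) ∧
      Submodule.span ℂ (Set.range (sVec hω hm q : Fin r → _)) = cartanC r hω f) ∧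
    ∀ σ ∈ sigmaSet r hω f,
      -- exactly one of the two cases occurs
      Xor (∃ l : Fin r, hyperplane σ = hyperplaneOne hω hm q l)
        (∃ k l : Fin r, k < l ∧ ∃ i j : Fin m,
          hyperplane σ = hyperplaneTwo hω hm q k l i j) ∧
      -- case (1)
      (∀ l : Fin r, hyperplane σ = hyperplaneOne hω hm q l →
        (∃ ε : ℂ, ε ^ m = (-1) ^ (m + 1)) ∧
        ∀ ε : ℂ, ε ^ m = (-1) ^ (m + 1) →
          (∃ L : Fin m → ℂ, IsLogVector m ω ε L ∧ ∑ j, L j = 0) ∧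
          ∀ L : Fin m → ℂ, IsLogVector m ω ε L →
            ∃ a : Fin m → ℂ,
              (∀ b : Fin m → ℂ, (vandermondeA m ω).mulVec b = L ↔ b = a) ∧
              a = (1 / (m : ℂ)) • ((vandermondeA m ω).map star).mulVec L ∧
              (a 0 = 0 ↔ ∑ j, L j = 0) ∧
              ExpLiftsReflection (theta r hω f) ω σ (rowSum hω f l a)) ∧
      -- case (2)
      (∀ (k l : Fin r) (hkl : k < l) (i j : Fin m),
        hyperplane σ = hyperplaneTwo hω hm q k l i j →
        ExpLiftsReflection (theta r hω f) ω σ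
          (rotation hω f (i := Sum.inl (k, i)) (j := Sum.inl (l, j))
            (fun h => hkl.ne (congrArg Prod.fst (Sum.inl_injective h))))) := by
  refine ⟨⟨isCartanSubspace_cartanC hm hr hω f hf, linearIndependent_sVec hω hm,
    span_sVec hω hm f⟩, fun σ hσ => ⟨hyperplane_xor hω hm f hσ, fun l hl =>
    ⟨exists_pow_eq_neg_one_pow m, fun ε hε => ⟨exists_isLogVector_sum_eq_zero hω hε,
      fun L hL => ?_⟩⟩, fun k l hkl i j h =>
        expLiftsReflection_rotation hω hm f hσ.1 hkl.ne i j _ h⟩⟩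
  refine ⟨_, vandermondeA_mulVec_eq_iff hω L, rfl, ?_, expLiftsReflection_rowSum hω hm f hσ.1 l hl
    hL ((vandermondeA_mulVec_eq_iff hω L _).2 rfl)⟩
  have hm0 : (m : ℂ) ≠ 0 := Nat.cast_ne_zero.2 (NeZero.ne m)
  rw [Pi.smul_apply, Matrix.mulVec, dotProduct, smul_eq_mul, mul_eq_zero,
    or_iff_right (one_div_ne_zero hm0)]
  -- Row `0` of the conjugate Vandermonde matrix consists of ones, so `a 0` is the mean of the `L
  -- j`.
  have h1 : ∀ j, (vandermondeA m ω).map star 0 j * L j = L j := fun j => by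
    rw [vandermondeA_map_star_apply hω]
    simp
  rw [Finset.sum_congr rfl fun j _ => h1 j]
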